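/- Let $G$ be a locally compact, second countable (Hausdorff) group. Say that $G$ has the Haagerup property if there is a sequence of continuous positive definite functions $\varphi_n:G\to\mathbb C$, vanishing at infinity, with $\varphi_n(e)=1$ and $\varphi_n\to 1$ uniformly on compact subsets of $G$. A dynamical system $(\Omega,\mathcal B,\mu,G)$ is a measure space on which $G$ acts by measurable automorphisms preserving $\mu$; it is a $C_0$-dynamical system if $\lim_{g\to\infty}\mu(gA\cap B)=0$ for all $A,B\in\mathcal B$ with $\mu(A),\mu(B)<\infty$. Let $\pi_\Omega$ be the unitary representation of $G$ on the complex Hilbert space $L^2(\Omega,\mu)$ given by $(\pi_\Omega(g)\xi)(x)=\xi(g^{-1}x)$. An invariant mean is a positive linear functional $m$ on $L^\infty(\Omega,\mu)$ with $m(1)=1$ and $m(g\cdot f)=m(f)$ for all $g\in G$ and $f\in L^\infty(\Omega,\mu)$, where $(g\cdot f)(x)=f(g^{-1}x)$. (a) If $G$ has the Haagerup property, then there is a $C_0$-dynamical system $(\Omega,\mathcal B,\mu,G)$ such that $L^\infty(\Omega,\mu)$ has an invariant mean and, moreover: (1) $\mu$ is $\sigma$-finite and $G$-invariant, $L^2(\Omega,\mu)$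 is separable, and $\pi_\Omega$ is strongly continuous; (2) $\lim_{g\to\infty}\mu(gA\cap B)=0$ for all $A,B\in\mathcal B$ of finite measure, and $\lim_{g\to\infty}\langle\pi_\Omega(g)\xi|\eta\rangle=0$ for all $\xi,\eta\in L^2(\Omega,\mu)$, that is, $\pi_\Omega$ is a $C_0$-representation; (3) there are unit vectors $\xi_n\in L^2(\Omega,\mu)$, $\xi_n\ge 0$, such that for every compact set $K\subset G$ $$\lim_{n\to\infty}\sup_{g\in K}|\langle\pi_\Omega(g)\xi_n|\xi_n\rangle-1|=0.$$ (b) Conversely, if there is a $C_0$-dynamical system $(\Omega,\mathcal B,\mu,G)$ with $\mu$ $\sigma$-finite and $\pi_\Omega$ strongly continuous such that $L^\infty(\Omega,\mu)$ has an invariant mean, then $G$ has the Haagerup property. -/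

import Mathlib

open MeasureTheory Filter Topology
open scoped Pointwise ENNReal ZeroAtInfty ComplexOrder

universe u

/-- A function `φ : G → ℂ` on a group is positive definite if every matrix
`(φ (gᵢ⁻¹ gⱼ))ᵢⱼ` built from finitely many elements of `G` is positive semidefinite. -/
def IsPositiveDefinite {G : Type u} [Group G] (φ : G → ℂ) : Prop :=
  ∀ (n : ℕ) (g : Fin n → G),
    (Matrix.of fun i j : Fin n => φ ((g i)⁻¹ * g j)).PosSemidef

/-- The Haagerup property: there is a sequence of normalized positive definite functions in
`C₀(G)` which converges to the constant function `1` uniformly on compact subsets of `G`. -/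
def HasHaagerupProperty (G : Type u) [Group G] [TopologicalSpace G] : Prop :=
  ∃ φ : ℕ → C₀(G, ℂ),
    (∀ n, IsPositiveDefinite (φ n)) ∧ (∀ n, φ n 1 = 1) ∧
    ∀ K : Set G, IsCompact K →
      TendstoUniformlyOn (fun (n : ℕ) (g : G) => φ n g) (fun _ => 1) atTop K

section DynamicalSystem

/-!
A measure-preserving dynamical system `(Ω, 𝓑, μ, G)` is given by an action `MulAction G Ω` of `G`
on a measurable space such that every `g` acts as a measurable map (hence, using `g⁻¹`, as an
automorphism of the measurable space; this is `MeasurableConstSMul G Ω`) and preserves `μ`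
(this is `SMulInvariantMeasure G Ω μ`).
-/

variable (G : Type u) [Group G] {Ω : Type u} [MeasurableSpace Ω] [MulAction G Ω]
  [MeasurableConstSMul G Ω] (μ : Measure Ω) [SMulInvariantMeasure G Ω μ]

/-- The measure-preserving system `(Ω, 𝓑, μ, G)` is a `C₀`-dynamical system if
`μ (gA ∩ B) → 0` as `g → ∞`, for all measurable `A`, `B` of finite measure. -/
def IsC0DynamicalSystem [TopologicalSpace G] : Prop :=
  ∀ A B : Set Ω, MeasurableSet A → MeasurableSet B → μ A < ∞ → μ B < ∞ →
    Tendsto (fun g : G => μ ((g • A) ∩ B)) (cocompact G) (𝓝 0)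

/-- The permutation representation `π_Ω` of `G` on the complex Hilbert space `L²(Ω, μ)`,
`(π_Ω(g) ξ)(x) = ξ (g⁻¹ x)`, as a homomorphism to the unitary group of `L²(Ω, μ)`. -/
noncomputable def permRep : G →* (Lp ℂ 2 μ ≃ₗᵢ[ℂ] Lp ℂ 2 μ) where
  toFun g :=
    { toFun := fun ξ => DomMulAct.mk g⁻¹ • ξ
      invFun := fun ξ => DomMulAct.mk g • ξ
      left_inv := fun ξ => by
        change DomMulAct.mk g • DomMulAct.mk g⁻¹ • ξ = ξ
        rw [smul_smul, ← DomMulAct.mk_mul]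
        simp
      right_inv := fun ξ => by
        change DomMulAct.mk g⁻¹ • DomMulAct.mk g • ξ = ξ
        rw [smul_smul, ← DomMulAct.mk_mul]
        simp
      map_add' := fun ξ η => smul_add _ ξ η
      map_smul' := fun c ξ => smul_comm _ c ξ
      norm_map' := fun ξ => DomMulAct.norm_smul_Lp _ ξ }
  map_one' := by
    ext1 ξ
    change DomMulAct.mk (1 : G)⁻¹ • ξ = ξ
    simp
  map_mul' g h := by
    ext1 ξ
    change DomMulAct.mk (g * h)⁻¹ • ξ = DomMulAct.mk g⁻¹ • DomMulAct.mk h⁻¹ • ξ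
    rw [smul_smul, ← DomMulAct.mk_mul, mul_inv_rev]

theorem permRep_apply_ae (g : G) (ξ : Lp ℂ 2 μ) :
    permRep G μ g ξ =ᵐ[μ] fun x => ξ (g⁻¹ • x) :=
  DomMulAct.smul_Lp_ae_eq (DomMulAct.mk g⁻¹) ξ

/-- The representation `π_Ω` is (strongly) continuous. -/
def IsContinuousPermRep [TopologicalSpace G] : Prop :=
  ∀ ξ : Lp ℂ 2 μ, Continuous fun g : G => permRep G μ g ξ

/-- All the matrix coefficients of `π_Ω` vanish at infinity. -/
def PermRepVanishesAtInfinity [TopologicalSpace G] : Prop :=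
  ∀ ξ η : Lp ℂ 2 μ, Tendsto (fun g : G => inner ℂ (permRep G μ g ξ) η) (cocompact G) (𝓝 0)

/-- `L^∞(Ω, μ)` has a `G`-invariant mean: a positive linear functional `m` with `m 1 = 1` and
`m (g · f) = m f`, where `(g · f)(x) = f (g⁻¹ x)`. -/
def HasInvariantMean : Prop :=
  ∃ m : Lp ℂ ∞ μ →ₗ[ℂ] ℂ,
    (∀ f : Lp ℂ ∞ μ, (∀ᵐ x ∂μ, 0 ≤ f x) → 0 ≤ m f) ∧
    m ((memLp_top_const (1 : ℂ)).toLp (fun _ => 1)) = 1 ∧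
    ∀ (g : G) (f : Lp ℂ ∞ μ), m (DomMulAct.mk g⁻¹ • f) = m f

/-- There is a sequence of nonnegative unit vectors `ξₙ` in `L²(Ω, μ)` such that
`⟨π_Ω(g) ξₙ | ξₙ⟩ → 1` uniformly for `g` in compact subsets of `G`. -/
def HasAlmostInvariantUnitVectors [TopologicalSpace G] : Prop :=
  ∃ ξ : ℕ → Lp ℂ 2 μ,
    (∀ n, ‖ξ n‖ = 1) ∧ (∀ n, ∀ᵐ x ∂μ, 0 ≤ ξ n x) ∧
    ∀ K : Set G, IsCompact K →
      TendstoUniformlyOn (fun (n : ℕ) (g : G) => inner ℂ (permRep G μ g (ξ n)) (ξ n))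
        (fun _ => 1) atTop K

end DynamicalSystem

/-!
**From the Haagerup property to a dynamical system.** A summable series `ψ = ∑ₖ 2 (1 - Re φₖ)` of
suitably chosen normalized positive definite `C₀`-functions is a continuous, proper, conditionally
negative definite function
(`HasHaagerupProperty.exists_isConditionallyNegativeDefinite`), so that `ψ (g⁻¹ h)` is the
squared distance `‖β g - β h‖²` for a map `β` into a Hilbert space with equivariant increments.
Let `W` be the centred Gaussian process on `G` with `E (W_g - W_h)² = ψ (g⁻¹ h)`. Its increments
have a translation invariant law, whereas `W` itself is pinned at a base point. Adding an
independent constant distributed according to Lebesgue measure absorbs the base point, so the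
σ-finite law `μ` of `g ↦ t + W_g` on `G → ℝ` is invariant under translations
(`exists_invariant_measure_pathSpace`). For the windows `{y | a < y g < b}` one finds

* `μ {a < y g < b} = b - a`;
* the windows at `g` and `h` differ by at most `2 √ψ(g⁻¹ h)`, since `t` has to fall near an end
  point;
* the windows at `g` and `h` intersect in measure at most `2 (b - a)² / √ψ(g⁻¹ h)`, since a Gaussian
  variable of large variance is rarely small.

Hence translations act continuously, are mixing (`ψ` is proper), and the windows
`{0 < y 1 < n}` of measure `n` form a Følner sequence because their translates differ from them by a
bounded amount. These facts pass from windows to all sets of finite measure by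
`HasWindowEstimates.mem_of_window_mem`; the Følner sequence gives the invariant mean and the almost
invariant vectors.

**From a dynamical system to the Haagerup property.** By duality, an invariant mean on `L^∞ = (L¹)*`
is in the weak-* closure of the set `P` of probability densities. Let `A` be the averaging operator
with respect to a probability density on `G`. An invariant mean is also invariant under such
averages (`map_comp_orbitAverage_eq`), so the Hahn–Banach theorem yields `p ∈ P` for which finitely
many of the `s · A p - A p` are small in norm. As `A p` moves equicontinuously in `p`, it is almost
invariant uniformly over a given compact set (`exists_almost_invariant_of_invariant_mean`). Then
`ξ = √(A p)` is an almost invariant unit vector of `L²`, and the coefficients `⟨g ξ, ξ⟩` are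
positive definite functions vanishing at infinity.
-/

/-! ### Approximation in measure and translations of `Lᵖ` functions -/

section Monotone

/-- An increasing sequence of sets approximates its union in measure. -/
theorem tendsto_measure_symmDiff_iUnion {Ω : Type*} [MeasurableSpace Ω] {μ : Measure Ω}
    {A : ℕ → Set Ω} (hA : ∀ n, MeasurableSet (A n)) (hmono : Monotone A) (hμ : μ (⋃ n, A n) ≠ ∞) :
    Tendsto (fun n => μ (symmDiff (A n) (⋃ n, A n))) atTop (𝓝 0) := by
  have h1 := ENNReal.Tendsto.sub (tendsto_const_nhds (x := μ (⋃ n, A n)))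
    (tendsto_measure_iUnion_atTop (μ := μ) hmono) (Or.inl hμ)
  rw [tsub_self] at h1
  refine h1.congr fun n => ?_
  have hn : A n ⊆ ⋃ n, A n := Set.subset_iUnion A n
  rw [Set.symmDiff_def, Set.sdiff_eq_empty.2 hn, Set.empty_union,
    measure_sdiff hn (hA n).nullMeasurableSet (measure_ne_top_of_subset hn hμ)]
  rfl

end Monotone

section Translation

/-- Convergence to `0` of an equi-Lipschitz family of maps is a closed condition on the point. -/
theorem isClosed_setOf_tendsto_zero {ι H F : Type*} [SeminormedAddCommGroup H]
    [SeminormedAddCommGroup F] (B : ι → H → F) {C : ℝ}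
    (hB : ∀ i x y, ‖B i x - B i y‖ ≤ C * ‖x - y‖) (l : Filter ι) :
    IsClosed {x | Tendsto (fun i => B i x) l (𝓝 0)} := by
  refine isClosed_of_closure_subset fun x hx => ?_
  rw [Set.mem_ofPred_eq, Metric.tendsto_nhds]
  intro ε hε
  have hC : 0 < 2 * (|C| + 1) := by positivity
  obtain ⟨y, hy, hxy⟩ := Metric.mem_closure_iff.1 hx (ε / (2 * (|C| + 1))) (by positivity)
  filter_upwards [(Metric.tendsto_nhds.1 hy) (ε / 2) (by positivity)] with i hi
  rw [dist_zero_right] at hi ⊢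
  have h1 : ‖B i x‖ ≤ ‖B i x - B i y‖ + ‖B i y‖ := by
    simpa using norm_add_le (B i x - B i y) (B i y)
  have h2 : C * ‖x - y‖ ≤ (|C| + 1) * ‖x - y‖ := by
    gcongr
    linarith [le_abs_self C]
  have h3 : (|C| + 1) * ‖x - y‖ < ε / 2 := by
    rw [dist_eq_norm, lt_div_iff₀ hC] at hxy
    linarith
  linarith [hB i x y]

variable {G : Type*} [Group G] {Ω : Type*} [MeasurableSpace Ω] [MulAction G Ω]
  [MeasurableConstSMul G Ω] {μ : Measure Ω} [SMulInvariantMeasure G Ω μ]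
  {E : Type*} [NormedAddCommGroup E] {p : ℝ≥0∞}

theorem mk_inv_smul_indicatorConstLp (g : G) {s : Set Ω} (hs : MeasurableSet s) (hμs : μ s ≠ ∞)
    (c : E) :
    DomMulAct.mk g⁻¹ • indicatorConstLp p hs hμs c =
      indicatorConstLp p (hs.const_smul g) (by rwa [measure_smul]) c := by
  rw [DomMulAct.mk_smul_indicatorConstLp]
  congr 1
  exact Set.preimage_smul_inv g s

variable [TopologicalSpace G]

/-- If `μ (gA ∆ A) → 0` as `g → 1` for all `A` of finite measure, then `g · f → f` in `Lᵖ`. -/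
theorem tendsto_smul_Lp_sub_self [Fact (1 ≤ p)] (hp : p ≠ ∞)
    (h : ∀ A : Set Ω, MeasurableSet A → μ A ≠ ∞ →
      Tendsto (fun g : G => μ (symmDiff (g • A) A)) (𝓝 1) (𝓝 0)) (f : Lp E p μ) :
    Tendsto (fun g : G => DomMulAct.mk g⁻¹ • f - f) (𝓝 1) (𝓝 0) := by
  induction f using Lp.induction hp with
  | indicatorConst c hs hμs =>
    rw [Lp.simpleFunc.coe_indicatorConst]
    simp_rw [mk_inv_smul_indicatorConstLp]
    refine tendsto_zero_iff_norm_tendsto_zero.2 ?_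
    have hp0 : p ≠ 0 := (zero_lt_one.trans_le (Fact.out : 1 ≤ p)).ne'
    simp_rw [← dist_eq_norm, dist_indicatorConstLp_eq_norm, norm_indicatorConstLp hp0 hp]
    have := ((ENNReal.tendsto_toReal ENNReal.zero_ne_top).comp (h _ hs hμs.ne)).rpow_const
      (p := 1 / p.toReal) (Or.inr (by positivity))
    have h0 : (1 / p.toReal) ≠ 0 := by
      simpa using (ENNReal.toReal_pos hp0 hp).ne'
    rw [ENNReal.toReal_zero, Real.zero_rpow h0] at this
    simpa only [mul_zero] using! this.const_mul ‖c‖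
  | add hf hg _ h1 h2 =>
    have := h1.add h2
    simp only [add_zero] at this
    refine this.congr fun g => ?_
    rw [smul_add]
    abel
  | isClosed =>
    refine isClosed_setOf_tendsto_zero (C := 2)
      (fun (g : G) (f : Lp E p μ) => DomMulAct.mk g⁻¹ • f - f) (fun g f f' => ?_) _
    have : DomMulAct.mk g⁻¹ • f - f - (DomMulAct.mk g⁻¹ • f' - f')
        = DomMulAct.mk g⁻¹ • (f - f') - (f - f') := by
      rw [smul_sub]; abel
    rw [this]
    refine (norm_sub_le _ _).trans_eq ?_
    rw [DomMulAct.norm_smul_Lp]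
    ring

/-- An isometric action on `Lᵖ` which is continuous at the identity is strongly continuous. -/
theorem continuous_smul_Lp [IsTopologicalGroup G] [Fact (1 ≤ p)] (f : Lp E p μ)
    (h : Tendsto (fun g : G => DomMulAct.mk g⁻¹ • f - f) (𝓝 1) (𝓝 0)) :
    Continuous fun g : G => DomMulAct.mk g⁻¹ • f := by
  refine continuous_iff_continuousAt.2 fun g₀ => ?_
  refine tendsto_iff_norm_sub_tendsto_zero.2 ?_
  have h1 : Tendsto (fun g : G => g₀⁻¹ * g) (𝓝 g₀) (𝓝 1) := by
    have : Continuous fun g : G => g₀⁻¹ * g := by fun_prop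
    simpa using this.tendsto g₀
  refine ((tendsto_zero_iff_norm_tendsto_zero.1 h).comp h1).congr fun g => ?_
  have : DomMulAct.mk g⁻¹ • f - DomMulAct.mk g₀⁻¹ • f
      = DomMulAct.mk g₀⁻¹ • (DomMulAct.mk (g₀⁻¹ * g)⁻¹ • f - f) := by
    rw [smul_sub, smul_smul, ← DomMulAct.mk_mul]
    simp
  rw [this, DomMulAct.norm_smul_Lp]
  rfl

/-- Conversely to `tendsto_smul_Lp_sub_self`, strong continuity on `L²` gives the continuity of
`g ↦ gA` in measure. -/
theorem tendsto_measure_smul_symmDiff (h : ∀ f : Lp ℂ 2 μ,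
      Continuous fun g : G => DomMulAct.mk g⁻¹ • f) {A : Set Ω}
    (hA : MeasurableSet A) (hμA : μ A ≠ ∞) :
    Tendsto (fun g : G => μ (symmDiff (g • A) A)) (𝓝 1) (𝓝 0) := by
  have h1 := (h (indicatorConstLp 2 hA hμA 1)).tendsto 1
  rw [tendsto_iff_norm_sub_tendsto_zero] at h1
  simp only [inv_one, DomMulAct.mk_one, one_smul, mk_inv_smul_indicatorConstLp] at h1
  simp_rw [← dist_eq_norm, dist_indicatorConstLp_eq_norm,
    norm_indicatorConstLp two_ne_zero ENNReal.ofNat_ne_top] at h1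
  have h2 := h1.pow 2
  have hfin : ∀ g : G, μ (symmDiff (g • A) A) ≠ ∞ := fun g => by
    have : μ (g • A) ≠ ∞ := by rwa [measure_smul]
    finiteness
  have h3 : Tendsto (fun g : G => (μ (symmDiff (g • A) A)).toReal) (𝓝 1) (𝓝 0) := by
    refine Tendsto.congr (fun g => ?_) (by simpa only [zero_pow two_ne_zero] using h2)
    rw [ENNReal.toReal_ofNat, ← Real.sqrt_eq_rpow, norm_one, one_mul,
      Real.sq_sqrt measureReal_nonneg]
    rfl
  have := ENNReal.tendsto_ofReal h3
  simpa [ENNReal.ofReal_toReal (hfin _)] using this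

/-- In a `C₀`-dynamical system all coefficients of the permutation representation vanish at
infinity. -/
theorem IsC0DynamicalSystem.permRepVanishesAtInfinity {G : Type u} [Group G] [TopologicalSpace G]
    {Ω : Type u} [MeasurableSpace Ω] [MulAction G Ω] [MeasurableConstSMul G Ω] {μ : Measure Ω}
    [SMulInvariantMeasure G Ω μ] (h : IsC0DynamicalSystem G μ) :
    PermRepVanishesAtInfinity G μ := by
  intro ξ η
  induction ξ using Lp.induction (p := 2) ENNReal.ofNat_ne_top with
  | @indicatorConst c s hs hμs =>
    induction η using Lp.induction (p := 2) ENNReal.ofNat_ne_top with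
    | @indicatorConst d t ht hμt =>
      simp_rw [Lp.simpleFunc.coe_indicatorConst]
      change Tendsto (fun g : G => inner ℂ (DomMulAct.mk g⁻¹ • indicatorConstLp 2 hs hμs.ne c)
        (indicatorConstLp 2 ht hμt.ne d)) _ _
      simp_rw [mk_inv_smul_indicatorConstLp, L2.inner_indicatorConstLp_indicatorConstLp]
      have := ((ENNReal.tendsto_toReal ENNReal.zero_ne_top).comp (h s t hs ht hμs hμt)).smul_const
        (inner ℂ c d)
      simpa [measureReal_def] using this
    | add hf hg _ h1 h2 => simpa only [inner_add_right, add_zero] using h1.add h2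
    | isClosed =>
      refine isClosed_setOf_tendsto_zero (C := ‖Lp.simpleFunc.indicatorConst 2 hs hμs.ne c‖)
        (fun (g : G) (η : Lp ℂ 2 μ) => inner ℂ (permRep G μ g _) η) (fun g η η' => ?_) _
      rw [← inner_sub_right]
      refine (norm_inner_le_norm _ _).trans_eq ?_
      rw [LinearIsometryEquiv.norm_map]
      rfl
  | add hf hg _ h1 h2 => simpa only [map_add, inner_add_left, add_zero] using h1.add h2
  | isClosed =>
    refine isClosed_setOf_tendsto_zero (C := ‖η‖)
      (fun (g : G) (ξ : Lp ℂ 2 μ) => inner ℂ (permRep G μ g ξ) η) (fun g ξ ξ' => ?_) _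
    rw [← inner_sub_left, ← map_sub]
    refine (norm_inner_le_norm _ _).trans_eq ?_
    rw [LinearIsometryEquiv.norm_map, mul_comm]

end Translation

/-! ### The dual of real `L¹` -/

section DualL1

variable {Ω : Type*} [MeasurableSpace Ω] {μ : Measure Ω}

variable (μ) in
/-- The canonical map `L^∞ → (L¹)*` given by integration against a bounded function. -/
noncomputable def linftyToDual : Lp ℝ ∞ μ →L[ℝ] StrongDual ℝ (Lp ℝ 1 μ) :=
  (ContinuousLinearMap.mul ℝ ℝ).lpPairing μ ∞ 1

theorem linftyToDual_apply (F : Lp ℝ ∞ μ) (h : Lp ℝ 1 μ) :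
    linftyToDual μ F h = ∫ x, F x * h x ∂μ := by
  rw [linftyToDual, ContinuousLinearMap.lpPairing_eq_integral]
  rfl

theorem linftyToDual_indicator (F : Lp ℝ ∞ μ) {A : Set Ω} (hA : MeasurableSet A) (hμA : μ A ≠ ∞) :
    linftyToDual μ F (indicatorConstLp 1 hA hμA 1) = ∫ x in A, F x ∂μ := by
  rw [linftyToDual_apply, ← integral_indicator hA]
  refine integral_congr_ae ?_
  filter_upwards [indicatorConstLp_coeFn (p := 1) (hs := hA) (hμs := hμA) (c := (1 : ℝ))] with x hx
  rw [hx]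
  by_cases h : x ∈ A <;> simp [h]

theorem integrableOn_linfty {E : Type*} [NormedAddCommGroup E] (F : Lp E ∞ μ) {A : Set Ω}
    (hμA : μ A < ∞) : IntegrableOn F A μ := by
  have : Fact (μ A < ∞) := ⟨hμA⟩
  have h := (Lp.memLp F).restrict A
  exact memLp_one_iff_integrable.1 (h.mono_exponent le_top)

/-- A bounded function is at least `δ` if its integral against `1_A` is at least `δ μ(A)`. -/
theorem ae_le_of_le_linftyToDual [SigmaFinite μ] (F : Lp ℝ ∞ μ) (δ : ℝ)
    (h : ∀ (A : Set Ω) (hA : MeasurableSet A) (hμA : μ A ≠ ∞),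
      δ * μ.real A ≤ linftyToDual μ F (indicatorConstLp 1 hA hμA 1)) : ∀ᵐ x ∂μ, δ ≤ F x := by
  have := ae_nonneg_of_forall_setIntegral_nonneg_of_sigmaFinite (μ := μ) (f := fun x => F x - δ)
    (fun s _ hμs => (integrableOn_linfty F hμs).sub (integrableOn_const hμs.ne)) fun s hs hμs => by
      rw [integral_sub (integrableOn_linfty F hμs) (integrableOn_const hμs.ne),
        ← linftyToDual_indicator F hs hμs.ne, setIntegral_const, smul_eq_mul]
      linarith [h s hs hμs.ne]
  filter_upwards [this] with x hx
  simpa using hx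

theorem linftyToDual_injective [SigmaFinite μ] : Function.Injective (linftyToDual μ) := by
  refine (injective_iff_map_eq_zero _).2 fun F hF => ?_
  have h1 := ae_le_of_le_linftyToDual F 0 fun A hA hμA => by rw [hF]; simp
  have h2 := ae_le_of_le_linftyToDual (-F) 0 fun A hA hμA => by rw [map_neg, hF]; simp
  refine Lp.ext ?_
  filter_upwards [h1, h2, Lp.coeFn_neg F, Lp.coeFn_zero ℝ ∞ μ] with x h1 h2 h3 h4
  rw [h3, Pi.neg_apply] at h2
  rw [h4, Pi.zero_apply]
  linarith

/-- A σ-finite measure has a strictly positive square integrable function. -/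
theorem exists_pos_memLp_two (μ : Measure Ω) [SigmaFinite μ] :
    ∃ u : Ω → ℝ, (∀ x, 0 < u x) ∧ Measurable u ∧ MemLp u 2 μ := by
  obtain ⟨g, hg, hgm, hgi⟩ := exists_pos_lintegral_lt_of_sigmaFinite μ one_ne_zero
  refine ⟨fun x => √(g x), fun x => Real.sqrt_pos.2 (by exact_mod_cast hg x), by fun_prop, ?_⟩
  rw [memLp_two_iff_integrable_sq (by fun_prop)]
  simp_rw [Real.sq_sqrt (NNReal.coe_nonneg _)]
  refine ⟨by fun_prop, ?_⟩
  simpa [HasFiniteIntegral] using hgi.trans ENNReal.one_lt_top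

theorem holderL_mul_ae_eq {u : Ω → ℝ} (hu2 : MemLp u 2 μ) (k : Lp ℝ 2 μ) :
    (ContinuousLinearMap.mul ℝ ℝ).holderL μ 2 2 1 (hu2.toLp u) k =ᵐ[μ] fun x => u x * k x := by
  rw [ContinuousLinearMap.holderL_apply_apply]
  refine ((ContinuousLinearMap.mul ℝ ℝ).coeFn_holder (hu2.toLp u) k).trans ?_
  filter_upwards [hu2.coeFn_toLp] with x hx
  simp [hx]

/-- Products of a fixed strictly positive `u ∈ L²` with elements of `L²` are dense in `L¹`. -/
theorem denseRange_mul_of_pos {u : Ω → ℝ} (hu : ∀ x, 0 < u x) (hum : Measurable u)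
    (hu2 : MemLp u 2 μ) :
    DenseRange ((ContinuousLinearMap.mul ℝ ℝ).holderL μ 2 2 1 (hu2.toLp u)) := by
  set T := (ContinuousLinearMap.mul ℝ ℝ).holderL μ 2 2 1 (hu2.toLp u)
  have hTk : ∀ k : Lp ℝ 2 μ, T k =ᵐ[μ] fun x => u x * k x := holderL_mul_ae_eq hu2
  intro h
  rw [← T.coe_coe, ← LinearMap.coe_range]
  induction h using Lp.induction (p := 1) ENNReal.one_ne_top with
  | @indicatorConst c s hs hμs =>
    rw [Lp.simpleFunc.coe_indicatorConst]
    let A : ℕ → Set Ω := fun n => s ∩ {x | ((n : ℝ) + 1)⁻¹ ≤ u x}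
    have hA : ∀ n, MeasurableSet (A n) := fun n =>
      hs.inter (measurableSet_le measurable_const hum)
    have hAs : ∀ n, A n ⊆ s := fun n => Set.inter_subset_left
    have hμA : ∀ n, μ (A n) ≠ ∞ := fun n => ((measure_mono (hAs n)).trans_lt hμs).ne
    have hmono : Monotone A := fun m n hmn => by
      refine Set.inter_subset_inter_right _ fun x hx => le_trans ?_ (Set.mem_ofPred_eq ▸ hx)
      gcongr
    have hun : ⋃ n, A n = s := by
      refine Set.Subset.antisymm (Set.iUnion_subset hAs) fun x hx => ?_
      obtain ⟨n, hn⟩ := exists_nat_gt (u x)⁻¹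
      refine Set.mem_iUnion.2 ⟨n, hx, ?_⟩
      refine inv_le_of_inv_le₀ (hu x) ?_
      linarith
    have hlim : Tendsto (fun n => μ (symmDiff (A n) s)) atTop (𝓝 0) := by
      rw [← hun]
      exact tendsto_measure_symmDiff_iUnion hA hmono (hun ▸ hμs.ne)
    refine mem_closure_of_tendsto
      (tendsto_indicatorConstLp_set (ht := hA) (hμt := hμA) (hs := hs) (hμs := hμs.ne)
        (c := c) ENNReal.one_ne_top hlim) (Eventually.of_forall fun n => ?_)
    have hk : MemLp ((A n).indicator fun x => c / u x) 2 μ := by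
      refine (memLp_indicator_const 2 (hA n) (c * ((n : ℝ) + 1)) (Or.inr (hμA n))).mono
        ((by fun_prop : Measurable fun x => c / u x).indicator (hA n)).aestronglyMeasurable
        (Eventually.of_forall fun x => ?_)
      by_cases hx : x ∈ A n
      · simp only [Set.indicator_of_mem hx, norm_div, norm_mul]
        rw [div_eq_mul_inv]
        gcongr
        rw [Real.norm_of_nonneg (hu x).le, Real.norm_of_nonneg (by positivity)]
        exact inv_le_of_inv_le₀ (by positivity) hx.2
      · simp [hx]
    refine ⟨hk.toLp _, Lp.ext ?_⟩
    filter_upwards [hTk (hk.toLp _), hk.coeFn_toLp,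
      indicatorConstLp_coeFn (p := 1) (hs := hA n) (hμs := hμA n) (c := c)] with x h1 h2 h3
    rw [ContinuousLinearMap.coe_coe, h1, h2, h3]
    by_cases hx : x ∈ A n
    · simp only [Set.indicator_of_mem hx]
      field_simp [(hu x).ne']
    · simp [hx]
  | add hf hg _ h1 h2 =>
    exact (T : Lp ℝ 2 μ →ₗ[ℝ] Lp ℝ 1 μ).range.topologicalClosure.add_mem h1 h2
  | isClosed => exact isClosed_closure

/-- Every bounded functional on `L¹` of a σ-finite measure is integration against a bounded
function. Restricting to products with a fixed positive `u ∈ L²` gives a functional on `L²`, hence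
a density `g ∈ L²` by the Riesz representation theorem, and `g / u` is bounded. -/
theorem linftyToDual_surjective [SigmaFinite μ] : Function.Surjective (linftyToDual μ) := by
  intro ℓ
  obtain ⟨u, hu, hum, hu2⟩ := exists_pos_memLp_two μ
  set T := (ContinuousLinearMap.mul ℝ ℝ).holderL μ 2 2 1 (hu2.toLp u)
  have hTk : ∀ k : Lp ℝ 2 μ, T k =ᵐ[μ] fun x => u x * k x := holderL_mul_ae_eq hu2
  obtain ⟨g, hg⟩ := (InnerProductSpace.toDual ℝ (Lp ℝ 2 μ)).surjective (ℓ ∘L T)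
  have hgk : ∀ k : Lp ℝ 2 μ, ℓ (T k) = ∫ x, g x * k x ∂μ := fun k => by
    rw [← ContinuousLinearMap.comp_apply, ← hg, InnerProductSpace.toDual_apply_apply, L2.inner_def]
    refine integral_congr_ae (Eventually.of_forall fun x => ?_)
    simp [mul_comm]
  have hint : ∀ (f : Ω → ℝ), MemLp f 2 μ → ∀ s, μ s < ∞ → IntegrableOn f s μ := fun f hf s hμs => by
    have : Fact (μ s < ∞) := ⟨hμs⟩
    exact memLp_one_iff_integrable.1 ((hf.restrict s).mono_exponent (by norm_num))
  -- the density is bounded by `‖ℓ‖ u` on average over each set of finite measure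
  have key : ∀ s (hs : MeasurableSet s) (hμs : μ s < ∞),
      |∫ x in s, g x ∂μ| ≤ ‖ℓ‖ * ∫ x in s, u x ∂μ := fun s hs hμs => by
    have h1 : ∫ x in s, g x ∂μ = ℓ (T (indicatorConstLp 2 hs hμs.ne 1)) := by
      rw [hgk, ← integral_indicator hs]
      refine integral_congr_ae ?_
      filter_upwards [indicatorConstLp_coeFn (p := 2) (hs := hs) (hμs := hμs.ne)
        (c := (1 : ℝ))] with x hx
      rw [hx]
      by_cases h : x ∈ s <;> simp [h]
    have h2 : ‖T (indicatorConstLp 2 hs hμs.ne 1)‖ = ∫ x in s, u x ∂μ := by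
      rw [L1.norm_eq_integral_norm, ← integral_indicator hs]
      refine integral_congr_ae ?_
      filter_upwards [indicatorConstLp_coeFn (p := 2) (hs := hs) (hμs := hμs.ne)
        (c := (1 : ℝ)), hTk (indicatorConstLp 2 hs hμs.ne 1)] with x hx hx'
      rw [hx', hx]
      by_cases h : x ∈ s <;> simp [h, abs_of_pos (hu x)]
    rw [h1, ← h2, ← Real.norm_eq_abs]
    exact ℓ.le_opNorm _
  have hup : ∀ᵐ x ∂μ, g x ≤ ‖ℓ‖ * u x := by
    have := ae_nonneg_of_forall_setIntegral_nonneg_of_sigmaFinite (μ := μ)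
      (f := fun x => ‖ℓ‖ * u x - g x)
      (fun s _ hμs => ((hint u hu2 s hμs).const_mul _).sub (hint g (Lp.memLp g) s hμs))
      fun s hs hμs => by
        rw [integral_sub ((hint u hu2 s hμs).const_mul _) (hint g (Lp.memLp g) s hμs),
          integral_const_mul]
        linarith [le_abs_self (∫ x in s, g x ∂μ), key s hs hμs]
    filter_upwards [this] with x hx
    simpa using hx
  have hlow : ∀ᵐ x ∂μ, -(‖ℓ‖ * u x) ≤ g x := by
    have := ae_nonneg_of_forall_setIntegral_nonneg_of_sigmaFinite (μ := μ)
      (f := fun x => g x + ‖ℓ‖ * u x)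
      (fun s _ hμs => (hint g (Lp.memLp g) s hμs).add ((hint u hu2 s hμs).const_mul _))
      fun s hs hμs => by
        rw [integral_add (hint g (Lp.memLp g) s hμs) ((hint u hu2 s hμs).const_mul _),
          integral_const_mul]
        linarith [neg_abs_le (∫ x in s, g x ∂μ), key s hs hμs]
    filter_upwards [this] with x hx
    rw [Pi.zero_apply] at hx
    linarith
  have hF : MemLp (fun x => g x / u x) ∞ μ := by
    refine memLp_top_of_bound
      ((Lp.aestronglyMeasurable g).aemeasurable.div hum.aemeasurable).aestronglyMeasurable ‖ℓ‖ ?_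
    filter_upwards [hup, hlow] with x h1 h2
    rw [Real.norm_eq_abs, abs_div, abs_of_pos (hu x), div_le_iff₀ (hu x)]
    exact abs_le.2 ⟨h2, h1⟩
  refine ⟨hF.toLp _, ?_⟩
  refine ContinuousLinearMap.coeFn_injective ((denseRange_mul_of_pos hu hum hu2).equalizer
    (ContinuousLinearMap.continuous _) ℓ.continuous (funext fun k => ?_))
  rw [Function.comp_apply, Function.comp_apply]
  change _ = ℓ (T k)
  rw [hgk, linftyToDual_apply]
  refine integral_congr_ae ?_
  filter_upwards [hTk k, hF.coeFn_toLp] with x h1 h2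
  change _ * (T k) x = _
  rw [h1, h2]
  field_simp [(hu x).ne']

end DualL1

/-! ### Averages along orbits and almost invariant vectors -/

section OrbitAverage

theorem continuous_orbit_inv {G : Type*} [Group G] [TopologicalSpace G] [IsTopologicalGroup G]
    {E : Type*} [NormedAddCommGroup E] [NormedSpace ℝ E] (π : G →* (E ≃ₗᵢ[ℝ] E))
    (hπ : ∀ v, Continuous fun s => π s v) (v : E) : Continuous fun s => π s⁻¹ v :=
  (hπ v).comp continuous_inv

variable {G : Type*} [MeasurableSpace G] {ν : Measure G}

/-- The normalized indicator function of a set of finite measure. -/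
noncomputable def normalizedIndicator (ν : Measure G) {V : Set G} (hV : MeasurableSet V)
    (hνV : ν V ≠ ∞) : Lp ℝ 1 ν :=
  (ν.real V)⁻¹ • indicatorConstLp 1 hV hνV 1

theorem normalizedIndicator_ae {V : Set G} (hV : MeasurableSet V) (hνV : ν V ≠ ∞) :
    normalizedIndicator ν hV hνV =ᵐ[ν] V.indicator fun _ => (ν.real V)⁻¹ := by
  filter_upwards [Lp.coeFn_smul (ν.real V)⁻¹ (indicatorConstLp (E := ℝ) 1 hV hνV 1),
    indicatorConstLp_coeFn (p := 1) (hs := hV) (hμs := hνV) (c := (1 : ℝ))] with x h1 h2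
  rw [normalizedIndicator, h1, Pi.smul_apply, h2]
  by_cases h : x ∈ V <;> simp [h]

theorem integral_normalizedIndicator {V : Set G} (hV : MeasurableSet V) (hνV : ν V ≠ ∞)
    (hV0 : ν V ≠ 0) : ∫ s, normalizedIndicator ν hV hνV s ∂ν = 1 := by
  rw [integral_congr_ae (normalizedIndicator_ae hV hνV), integral_indicator hV, setIntegral_const,
    smul_eq_mul, mul_inv_cancel₀]
  exact ENNReal.toReal_ne_zero.2 ⟨hV0, hνV⟩

variable [TopologicalSpace G] [SecondCountableTopology G] [BorelSpace G]
  {E : Type*} [NormedAddCommGroup E] [NormedSpace ℝ E]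

theorem integrable_smul_orbit (ν : Measure G) {U : G → E ≃ₗᵢ[ℝ] E}
    (hU : ∀ v, Continuous fun s => U s v) (f : Lp ℝ 1 ν) (v : E) :
    Integrable (fun s => f s • U s v) ν := by
  refine ((L1.integrable_coeFn f).norm.mul_const ‖v‖).mono'
    ((Lp.aestronglyMeasurable f).smul (hU v).aestronglyMeasurable)
    (Eventually.of_forall fun s => ?_)
  rw [norm_smul, LinearIsometryEquiv.norm_map]

/-- The operators `v ↦ ∫ f(s) U(s)v ds` attached to a strongly continuous family `U` of isometries,
as a continuous linear function of `f ∈ L¹`. -/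
noncomputable def orbitAverage (ν : Measure G) (U : G → E ≃ₗᵢ[ℝ] E)
    (hU : ∀ v, Continuous fun s => U s v) : Lp ℝ 1 ν →L[ℝ] E →L[ℝ] E :=
  LinearMap.mkContinuous₂
    (LinearMap.mk₂ ℝ (fun (f : Lp ℝ 1 ν) v => ∫ s, f s • U s v ∂ν)
      (fun f f' v => by
        rw [← integral_add (integrable_smul_orbit ν hU f v) (integrable_smul_orbit ν hU f' v)]
        refine integral_congr_ae ?_
        filter_upwards [Lp.coeFn_add f f'] with s hs
        rw [hs, Pi.add_apply, add_smul])
      (fun c f v => by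
        rw [← integral_smul]
        refine integral_congr_ae ?_
        filter_upwards [Lp.coeFn_smul c f] with s hs
        rw [hs, Pi.smul_apply, smul_assoc])
      (fun f v v' => by
        rw [← integral_add (integrable_smul_orbit ν hU f v) (integrable_smul_orbit ν hU f v')]
        simp only [map_add, smul_add])
      (fun c f v => by
        rw [← integral_smul]
        simp only [map_smul, smul_comm c])) 1 fun f v => by
    rw [one_mul, LinearMap.mk₂_apply]
    refine (norm_integral_le_integral_norm _).trans_eq ?_
    simp_rw [norm_smul, LinearIsometryEquiv.norm_map]
    rw [integral_mul_const, ← L1.norm_eq_integral_norm]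

theorem orbitAverage_apply {U : G → E ≃ₗᵢ[ℝ] E} (hU : ∀ v, Continuous fun s => U s v)
    (f : Lp ℝ 1 ν) (v : E) : orbitAverage ν U hU f v = ∫ s, f s • U s v ∂ν := rfl

theorem norm_orbitAverage_le {U : G → E ≃ₗᵢ[ℝ] E} (hU : ∀ v, Continuous fun s => U s v)
    (f : Lp ℝ 1 ν) : ‖orbitAverage ν U hU f‖ ≤ ‖f‖ := by
  refine ((orbitAverage ν U hU).le_opNorm f).trans ?_
  refine mul_le_of_le_one_left (norm_nonneg _) ?_
  exact LinearMap.mkContinuous₂_norm_le _ zero_le_one _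

theorem norm_orbitAverage_sub_le {U : G → E ≃ₗᵢ[ℝ] E} (hU : ∀ v, Continuous fun s => U s v)
    (f f' : Lp ℝ 1 ν) : ‖orbitAverage ν U hU f - orbitAverage ν U hU f'‖ ≤ ‖f - f'‖ := by
  rw [← map_sub]
  exact norm_orbitAverage_le hU _

/-- Averaging over a set of finite positive measure stays in every closed convex set containing
the values. -/
theorem orbitAverage_normalizedIndicator_mem [CompleteSpace E] {U : G → E ≃ₗᵢ[ℝ] E}
    (hU : ∀ v, Continuous fun s => U s v) {V : Set G} (hV : MeasurableSet V) (hνV : ν V ≠ ∞)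
    (hV0 : ν V ≠ 0) {P : Set E} (hP : Convex ℝ P) (hPc : IsClosed P) {v : E}
    (h : ∀ s ∈ V, U s v ∈ P) :
    orbitAverage ν U hU (normalizedIndicator ν hV hνV) v ∈ P := by
  have h1 : orbitAverage ν U hU (normalizedIndicator ν hV hνV) v = ⨍ s in V, U s v ∂ν := by
    rw [orbitAverage_apply, setAverage_eq, ← integral_smul, ← integral_indicator hV]
    refine integral_congr_ae ?_
    filter_upwards [normalizedIndicator_ae hV hνV] with s hs
    rw [hs]
    by_cases h : s ∈ V <;> simp [h]
  rw [h1]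
  refine hP.set_average_mem hPc hV0 hνV ((ae_restrict_iff' hV).2 (Eventually.of_forall h)) ?_
  have : Fact (ν V < ∞) := ⟨hνV.lt_top⟩
  refine (integrable_const ‖v‖).mono' (hU v).aestronglyMeasurable (Eventually.of_forall fun s => ?_)
  rw [LinearIsometryEquiv.norm_map]

variable [Group G] [IsTopologicalGroup G] [LocallyCompactSpace G] [ν.IsHaarMeasure]
  (π : G →* (E ≃ₗᵢ[ℝ] E)) (hπ : ∀ v, Continuous fun s => π s v)

theorem orbitAverage_inv_map (t : G) (f : Lp ℝ 1 ν) (v : E) :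
    orbitAverage ν (fun s => π s⁻¹) (continuous_orbit_inv π hπ) f (π t v) =
      orbitAverage ν (fun s => π s⁻¹) (continuous_orbit_inv π hπ) (DomMulAct.mk t • f) v := by
  rw [orbitAverage_apply, orbitAverage_apply]
  have h1 : ∫ s, (DomMulAct.mk t • f) s • π s⁻¹ v ∂ν = ∫ s, f (t * s) • π s⁻¹ v ∂ν := by
    refine integral_congr_ae ?_
    filter_upwards [DomMulAct.smul_Lp_ae_eq (DomMulAct.mk t) f] with s hs
    rw [hs]
    rfl
  rw [h1, ← integral_mul_left_eq_self (fun s => f (t * s) • π s⁻¹ v) t⁻¹]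
  refine integral_congr_ae (Eventually.of_forall fun s => ?_)
  simp

theorem map_orbitAverage [CompleteSpace E] (t : G) (f : Lp ℝ 1 ν) (v : E) :
    π t (orbitAverage ν π hπ f v) = orbitAverage ν π hπ (DomMulAct.mk t⁻¹ • f) v := by
  rw [orbitAverage_apply, orbitAverage_apply]
  have h1 : ∫ s, (DomMulAct.mk t⁻¹ • f) s • π s v ∂ν = ∫ s, f (t⁻¹ * s) • π s v ∂ν := by
    refine integral_congr_ae ?_
    filter_upwards [DomMulAct.smul_Lp_ae_eq (DomMulAct.mk t⁻¹) f] with s hs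
    rw [hs]
    rfl
  rw [h1, ← integral_mul_left_eq_self (fun s => f (t⁻¹ * s) • π s v) t]
  have h2 := (π t).toContinuousLinearEquiv.toContinuousLinearMap.integral_comp_comm
    (integrable_smul_orbit ν hπ f v)
  refine h2.symm.trans (integral_congr_ae (Eventually.of_forall fun s => ?_))
  simp

theorem continuous_mk_smul_Lp (f : Lp ℝ 1 ν) : Continuous fun t : G => DomMulAct.mk t • f := by
  have : Fact ((1 : ℝ≥0∞) ≠ ∞) := ⟨ENNReal.one_ne_top⟩
  exact DomMulAct.continuous_mk.smul continuous_const

theorem integral_mk_smul_Lp (t : G) (f : Lp ℝ 1 ν) :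
    ∫ s, (DomMulAct.mk t • f) s ∂ν = ∫ s, f s ∂ν := by
  rw [← integral_mul_left_eq_self (fun s => f s) t]
  refine integral_congr_ae ?_
  filter_upwards [DomMulAct.smul_Lp_ae_eq (DomMulAct.mk t) f] with s hs
  rw [hs]
  rfl

variable [CompleteSpace E] (M : StrongDual ℝ E →L[ℝ] ℝ)
  (hM : ∀ (ℓ : StrongDual ℝ E) (t : G),
    M (ℓ ∘L (π t).toContinuousLinearEquiv.toContinuousLinearMap) = M ℓ)

include hM in
/-- An invariant functional on the dual does not see an average on the right of an operator
`∫ f(s) π(s⁻¹) ds`, because the right translates of the latter depend continuously, in norm, on the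
translating element. -/
theorem map_comp_orbitAverage_inv_comp (ℓ : StrongDual ℝ E) (χ ψ : Lp ℝ 1 ν)
    (hψ : ∫ s, ψ s ∂ν = 1) :
    M (ℓ ∘L orbitAverage ν (fun s => π s⁻¹) (continuous_orbit_inv π hπ) χ ∘L
      orbitAverage ν π hπ ψ) =
      M (ℓ ∘L orbitAverage ν (fun s => π s⁻¹) (continuous_orbit_inv π hπ) χ) := by
  set B := orbitAverage ν (fun s => π s⁻¹) (continuous_orbit_inv π hπ) with hB
  let Θ : G → StrongDual ℝ E := fun s => ℓ ∘L B (DomMulAct.mk s • χ)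
  have hΘ : ∀ s, Θ s = (ℓ ∘L B χ) ∘L (π s).toContinuousLinearEquiv.toContinuousLinearMap := by
    intro s
    ext v
    change ℓ (B (DomMulAct.mk s • χ) v) = ℓ (B χ (π s v))
    rw [hB, orbitAverage_inv_map π hπ]
  have hΘc : Continuous Θ :=
    (ContinuousLinearMap.postcomp E ℓ).continuous.comp (B.continuous.comp (continuous_mk_smul_Lp χ))
  have hint : Integrable (fun s => ψ s • Θ s) ν := by
    refine ((L1.integrable_coeFn ψ).norm.mul_const (‖ℓ‖ * ‖χ‖)).mono'
      ((Lp.aestronglyMeasurable ψ).smul hΘc.aestronglyMeasurable)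
      (Eventually.of_forall fun s => ?_)
    rw [norm_smul]
    gcongr
    refine (ContinuousLinearMap.opNorm_comp_le _ _).trans ?_
    gcongr
    refine (norm_orbitAverage_le _ _).trans_eq ?_
    rw [DomMulAct.norm_smul_Lp]
  have h1 : ℓ ∘L B χ ∘L orbitAverage ν π hπ ψ = ∫ s, ψ s • Θ s ∂ν := by
    ext v
    rw [ContinuousLinearMap.integral_apply hint, ← ContinuousLinearMap.comp_assoc,
      ContinuousLinearMap.comp_apply, orbitAverage_apply,
      ← ContinuousLinearMap.integral_comp_comm _ (integrable_smul_orbit ν hπ ψ v)]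
    refine integral_congr_ae (Eventually.of_forall fun s => ?_)
    simp [hΘ]
  rw [h1, ← ContinuousLinearMap.integral_comp_comm _ hint]
  have h2 : ∀ s, M (ψ s • Θ s) = ψ s * M (ℓ ∘L B χ) := fun s => by
    rw [map_smul, hΘ, hM, smul_eq_mul]
  simp_rw [h2]
  rw [integral_mul_const, hψ, one_mul]

include hM in
/-- An invariant functional on the dual is also invariant under averaging: `M (ℓ ∘ A_ψ)` does not
depend on the weight `ψ` of integral one. Composing with averages over small neighbourhoods of the
identity changes `A_ψ` little, and yields a value that does not involve `ψ`. -/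
theorem map_comp_orbitAverage_eq (ℓ : StrongDual ℝ E) (ψ ψ' : Lp ℝ 1 ν)
    (hψ : ∫ s, ψ s ∂ν = 1) (hψ' : ∫ s, ψ' s ∂ν = 1) :
    M (ℓ ∘L orbitAverage ν π hπ ψ) = M (ℓ ∘L orbitAverage ν π hπ ψ') := by
  set B := orbitAverage ν (fun s => π s⁻¹) (continuous_orbit_inv π hπ) with hB
  have hnear : ∀ ψ : Lp ℝ 1 ν, ∀ ε > 0, ∀ᶠ s : G in 𝓝 1, ‖DomMulAct.mk s • ψ - ψ‖ < ε := by
    intro ψ ε hε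
    have h1 := (continuous_mk_smul_Lp ψ).tendsto 1
    rw [DomMulAct.mk_one, one_smul, tendsto_iff_norm_sub_tendsto_zero] at h1
    exact h1.eventually (gt_mem_nhds hε)
  obtain ⟨K, hK, hK1⟩ := exists_compact_mem_nhds (1 : G)
  have hclose : ∀ ε > 0, |M (ℓ ∘L orbitAverage ν π hπ ψ) - M (ℓ ∘L orbitAverage ν π hπ ψ')| ≤
      2 * (‖M‖ * (‖ℓ‖ * ε)) := by
    intro ε hε
    have hW := ((hnear ψ ε hε).and (hnear ψ' ε hε)).and hK1
    obtain ⟨V, hVW, hVo, hV1⟩ := mem_nhds_iff.1 hW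
    have hV := hVo.measurableSet
    have hνV : ν V ≠ ∞ :=
      ((measure_mono fun s hs => (hVW hs).2).trans_lt hK.measure_lt_top).ne
    have hV0 : ν V ≠ 0 := (hVo.measure_pos ν ⟨1, hV1⟩).ne'
    set χ := normalizedIndicator ν hV hνV
    have hstep : ∀ ψ : Lp ℝ 1 ν, (∫ s, ψ s ∂ν = 1) →
        (∀ s ∈ V, ‖DomMulAct.mk s • ψ - ψ‖ < ε) →
        |M (ℓ ∘L B χ) - M (ℓ ∘L orbitAverage ν π hπ ψ)| ≤ ‖M‖ * (‖ℓ‖ * ε) := by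
      intro ψ hψ hs
      rw [← map_comp_orbitAverage_inv_comp π hπ M hM ℓ χ ψ hψ, ← map_sub, ← Real.norm_eq_abs,
        ← ContinuousLinearMap.comp_sub]
      refine (M.le_opNorm _).trans ?_
      gcongr
      refine (ContinuousLinearMap.opNorm_comp_le _ _).trans ?_
      gcongr
      refine ContinuousLinearMap.opNorm_le_bound _ hε.le fun v => ?_
      rw [_root_.sub_apply, ContinuousLinearMap.comp_apply, ← dist_eq_norm,
        ← Metric.mem_closedBall]
      refine orbitAverage_normalizedIndicator_mem _ hV hνV hV0 (convex_closedBall _ _)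
        Metric.isClosed_closedBall fun s hsV => ?_
      rw [map_orbitAverage, inv_inv, Metric.mem_closedBall, dist_eq_norm,
        ← _root_.sub_apply, ← map_sub]
      refine (ContinuousLinearMap.le_opNorm _ _).trans ?_
      gcongr
      exact (norm_orbitAverage_le _ _).trans (hs s hsV).le
    have h1 := hstep ψ hψ fun s hs => (hVW hs).1.1
    have h2 := hstep ψ' hψ' fun s hs => (hVW hs).1.2
    rw [abs_le] at h1 h2 ⊢
    constructor <;> linarith [h1.1, h1.2, h2.1, h2.2]
  refine sub_eq_zero.1 (abs_eq_zero.1 (le_antisymm (le_of_forall_pos_le_add fun ε hε => ?_)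
    (abs_nonneg _)))
  have hC : 0 < 2 * (‖M‖ * ‖ℓ‖) + 1 := by positivity
  refine (hclose (ε / (2 * (‖M‖ * ‖ℓ‖) + 1)) (by positivity)).trans ?_
  rw [zero_add, show 2 * (‖M‖ * (‖ℓ‖ * (ε / (2 * (‖M‖ * ‖ℓ‖) + 1)))) =
    (2 * (‖M‖ * ‖ℓ‖)) * ε / (2 * (‖M‖ * ‖ℓ‖) + 1) by ring, div_le_iff₀ hC]
  nlinarith

include hM hπ in
/-- If the dual of a Banach space with an isometric representation carries an invariant functional
that is a "mean over `P`", where `P` is a closed convex bounded invariant set, then `P` contains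
vectors which are almost invariant, uniformly on a given compact set. Averaged vectors `A_ψ p` move
equicontinuously, so that only finitely many translations have to be controlled; these are handled
by the Hahn–Banach theorem. -/
theorem exists_almost_invariant_of_invariant_mean {P : Set E}
    (hP : Convex ℝ P) (hPc : IsClosed P)
    (hPπ : ∀ t, ∀ p ∈ P, π t p ∈ P) (hPb : ∀ p ∈ P, ‖p‖ ≤ 1)
    (hMP : ∀ (ℓ : StrongDual ℝ E) (δ : ℝ), (∀ p ∈ P, δ ≤ ℓ p) → δ ≤ M ℓ)
    {K : Set G} (hK : IsCompact K) {ε : ℝ} (hε : 0 < ε) :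
    ∃ p ∈ P, ∀ t ∈ K, ‖π t p - p‖ ≤ ε := by
  let ν : Measure G := Measure.haar
  obtain ⟨V₀, hV₀, hV₁⟩ := exists_compact_mem_nhds (1 : G)
  have hVo : IsOpen (interior V₀) := isOpen_interior
  have hV := hVo.measurableSet
  have hνV : ν (interior V₀) ≠ ∞ :=
    ((measure_mono interior_subset).trans_lt hV₀.measure_lt_top).ne
  have hV0 : ν (interior V₀) ≠ 0 :=
    (hVo.measure_pos ν ⟨1, mem_interior_iff_mem_nhds.2 hV₁⟩).ne'
  set ψ := normalizedIndicator ν hV hνV with hψ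
  have hψ1 : ∫ s, ψ s ∂ν = 1 := integral_normalizedIndicator hV hνV hV0
  set A := orbitAverage ν π hπ ψ with hA
  have hAP : ∀ p ∈ P, A p ∈ P := fun p hp =>
    orbitAverage_normalizedIndicator_mem hπ hV hνV hV0 hP hPc fun s _ => hPπ s p hp
  -- equicontinuity of the averaged vectors
  have hequi : ∀ᶠ s : G in 𝓝 1, ‖DomMulAct.mk s⁻¹ • ψ - ψ‖ < ε / 2 := by
    have h1 := ((continuous_mk_smul_Lp ψ).comp continuous_inv).tendsto (1 : G)
    simp only [Function.comp_apply, inv_one] at h1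
    rw [DomMulAct.mk_one, one_smul, tendsto_iff_norm_sub_tendsto_zero] at h1
    exact h1.eventually (gt_mem_nhds (by positivity))
  obtain ⟨W, hW, hWo, hW1⟩ := mem_nhds_iff.1 hequi
  obtain ⟨S, hS⟩ := hK.elim_finite_subcover (fun s : G => s • W) (fun s => hWo.smul s)
    fun t _ => Set.mem_iUnion.2 ⟨t, by simpa [Set.mem_smul_set_iff_inv_smul_mem] using hW1⟩
  classical
  let D : E →L[ℝ] (S → E) := ContinuousLinearMap.pi fun s =>
    (π s).toContinuousLinearEquiv.toContinuousLinearMap ∘L A - A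
  have h0 : (0 : S → E) ∈ closure (D '' P) := by
    -- a separating functional `F` would have `M (F ∘ D) > 0`, whereas invariance gives `0`
    by_contra hnot
    obtain ⟨F, c, hF0, hF⟩ := geometric_hahn_banach_point_closed
      (hP.linear_image D.toLinearMap).closure isClosed_closure hnot
    rw [map_zero] at hF0
    have hc : c ≤ M (F ∘L D) := hMP _ _ fun p hp =>
      (hF _ (subset_closure ⟨p, hp, rfl⟩)).le
    have hFD : F ∘L D = ∑ s : S,
        ((F ∘L ContinuousLinearMap.single ℝ (fun _ : S => E) s) ∘L
          orbitAverage ν π hπ (DomMulAct.mk (s : G)⁻¹ • ψ) -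
          (F ∘L ContinuousLinearMap.single ℝ (fun _ : S => E) s) ∘L A) := by
      ext p
      have h1 : D p = ∑ s : S, Pi.single s (D p s) := (Finset.univ_sum_single _).symm
      rw [ContinuousLinearMap.comp_apply, h1, map_sum, _root_.sum_apply]
      refine Finset.sum_congr rfl fun s _ => ?_
      rw [← ContinuousLinearMap.comp_sub]
      simp only [ContinuousLinearMap.comp_apply, _root_.sub_apply,
        ContinuousLinearMap.single_apply, ← map_orbitAverage]
      rfl
    have hM0 : M (F ∘L D) = 0 := by
      rw [hFD, map_sum]
      refine Finset.sum_eq_zero fun s _ => ?_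
      rw [map_sub, hA, map_comp_orbitAverage_eq π hπ M hM _ (DomMulAct.mk (s : G)⁻¹ • ψ) ψ
        ((integral_mk_smul_Lp _ _).trans hψ1) hψ1, sub_self]
    linarith
  obtain ⟨_, ⟨p, hp, rfl⟩, hpd⟩ := Metric.mem_closure_iff.1 h0 (ε / 2) (by positivity)
  refine ⟨A p, hAP p hp, fun t ht => ?_⟩
  obtain ⟨s, hs, hts⟩ := Set.mem_iUnion₂.1 (hS ht)
  rw [Set.mem_smul_set_iff_inv_smul_mem, smul_eq_mul] at hts
  have h1 : ‖π s (A p) - A p‖ ≤ ε / 2 := by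
    rw [dist_zero_left] at hpd
    exact (norm_le_pi_norm (D p) ⟨s, hs⟩).trans hpd.le
  have h2 : ‖π (s⁻¹ * t) (A p) - A p‖ ≤ ε / 2 := by
    rw [hA, map_orbitAverage, ← _root_.sub_apply]
    refine (ContinuousLinearMap.le_opNorm _ _).trans ?_
    have h3 := (norm_orbitAverage_sub_le hπ (DomMulAct.mk (s⁻¹ * t)⁻¹ • ψ) ψ).trans (hW hts).le
    calc _ ≤ ε / 2 * 1 := by gcongr; exact hPb p hp
      _ = ε / 2 := mul_one _
  have h4 : π t (A p) - A p = π s (π (s⁻¹ * t) (A p) - A p) + (π s (A p) - A p) := by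
    have h5 : π s (π (s⁻¹ * t) (A p)) = π t (A p) := by
      have h6 := map_mul π s (s⁻¹ * t)
      rw [mul_inv_cancel_left] at h6
      rw [h6]
      rfl
    rw [map_sub, h5]
    abel
  rw [h4]
  refine (norm_add_le _ _).trans ?_
  rw [LinearIsometryEquiv.norm_map]
  linarith

end OrbitAverage

/-! ### From an invariant mean to the Haagerup property -/

section InvariantMean

variable {G : Type u} [Group G] {Ω : Type u} [MeasurableSpace Ω] [MulAction G Ω]
  [MeasurableConstSMul G Ω] (μ : Measure Ω) [SMulInvariantMeasure G Ω μ]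

variable (G) in
/-- The isometric representation of `G` on real `L¹` by translations. -/
noncomputable def translationL1 : G →* (Lp ℝ 1 μ ≃ₗᵢ[ℝ] Lp ℝ 1 μ) where
  toFun g :=
    { toFun := fun ξ => DomMulAct.mk g⁻¹ • ξ
      invFun := fun ξ => DomMulAct.mk g • ξ
      left_inv := fun ξ => by
        change DomMulAct.mk g • DomMulAct.mk g⁻¹ • ξ = ξ
        rw [smul_smul, ← DomMulAct.mk_mul]
        simp
      right_inv := fun ξ => by
        change DomMulAct.mk g⁻¹ • DomMulAct.mk g • ξ = ξ
        rw [smul_smul, ← DomMulAct.mk_mul]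
        simp
      map_add' := fun ξ η => smul_add _ ξ η
      map_smul' := fun c ξ => smul_comm _ c ξ
      norm_map' := fun ξ => DomMulAct.norm_smul_Lp _ ξ }
  map_one' := by
    ext1 ξ
    change DomMulAct.mk (1 : G)⁻¹ • ξ = ξ
    simp
  map_mul' g h := by
    ext1 ξ
    change DomMulAct.mk (g * h)⁻¹ • ξ = DomMulAct.mk g⁻¹ • DomMulAct.mk h⁻¹ • ξ
    rw [smul_smul, ← DomMulAct.mk_mul, mul_inv_rev]

theorem translationL1_ae (g : G) (f : Lp ℝ 1 μ) :
    translationL1 G μ g f =ᵐ[μ] fun x => f (g⁻¹ • x) :=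
  DomMulAct.smul_Lp_ae_eq (DomMulAct.mk g⁻¹) f

variable {μ}

theorem linftyToDual_comp_translation (F : Lp ℝ ∞ μ) (t : G) :
    linftyToDual μ F ∘L (translationL1 G μ t).toContinuousLinearEquiv.toContinuousLinearMap =
      linftyToDual μ (DomMulAct.mk t • F) := by
  ext h
  change linftyToDual μ F (translationL1 G μ t h) = _
  rw [linftyToDual_apply, linftyToDual_apply, ← integral_smul_eq_self (g := t)
    (fun x => F x * (translationL1 G μ t h) x)]
  have h1 := (measurePreserving_smul t μ).quasiMeasurePreserving.ae (translationL1_ae μ t h)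
  refine integral_congr_ae ?_
  filter_upwards [h1, DomMulAct.smul_Lp_ae_eq (DomMulAct.mk t) F] with x h1 h2
  rw [h1, h2, inv_smul_smul]
  rfl

/-- The probability densities in `L¹`. -/
def probabilityDensities (μ : Measure Ω) : Set (Lp ℝ 1 μ) :=
  {p | 0 ≤ p ∧ ∫ x, p x ∂μ = 1}

theorem convex_probabilityDensities : Convex ℝ (probabilityDensities μ) := by
  rintro p ⟨hp, hp1⟩ q ⟨hq, hq1⟩ a b ha hb hab
  have hint : ∀ c : ℝ, ∀ r : Lp ℝ 1 μ, ∫ x, (c • r) x ∂μ = c * ∫ x, r x ∂μ := fun c r => by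
    rw [← integral_const_mul]
    refine integral_congr_ae ?_
    filter_upwards [Lp.coeFn_smul c r] with x hx
    rw [hx, Pi.smul_apply, smul_eq_mul]
  constructor
  · rw [← Lp.coeFn_nonneg] at hp hq ⊢
    filter_upwards [hp, hq, Lp.coeFn_add (a • p) (b • q), Lp.coeFn_smul a p, Lp.coeFn_smul b q]
      with x h1 h2 h3 h4 h5
    rw [h3, Pi.add_apply, h4, h5, Pi.smul_apply, Pi.smul_apply, smul_eq_mul, smul_eq_mul]
    exact add_nonneg (mul_nonneg ha h1) (mul_nonneg hb h2)
  · have : ∫ x, (a • p + b • q) x ∂μ = ∫ x, ((a • p) x + (b • q) x) ∂μ :=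
      integral_congr_ae (Lp.coeFn_add _ _)
    rw [this, integral_add (L1.integrable_coeFn _) (L1.integrable_coeFn _), hint, hint, hp1, hq1,
      mul_one, mul_one, hab]

theorem isClosed_probabilityDensities : IsClosed (probabilityDensities μ) :=
  have h1 : IsClosed {p : Lp ℝ 1 μ | ∫ x, p x ∂μ = 1} :=
    isClosed_eq continuous_integral continuous_const
  (isClosed_Ici (a := (0 : Lp ℝ 1 μ))).inter h1

theorem norm_eq_one_of_mem_probabilityDensities {p : Lp ℝ 1 μ}
    (hp : p ∈ probabilityDensities μ) : ‖p‖ = 1 := by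
  rw [L1.norm_eq_integral_norm, ← hp.2]
  refine integral_congr_ae ?_
  filter_upwards [(Lp.coeFn_nonneg p).2 hp.1] with x hx
  exact Real.norm_of_nonneg hx

theorem translationL1_mem_probabilityDensities (t : G) {p : Lp ℝ 1 μ}
    (hp : p ∈ probabilityDensities μ) : translationL1 G μ t p ∈ probabilityDensities μ := by
  constructor
  · rw [← Lp.coeFn_nonneg]
    have h1 := (measurePreserving_smul t⁻¹ μ).quasiMeasurePreserving.ae
      ((Lp.coeFn_nonneg p).2 hp.1)
    filter_upwards [h1, translationL1_ae μ t p] with x hx hx'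
    rw [hx']
    exact hx
  · rw [integral_congr_ae (translationL1_ae μ t p), integral_smul_eq_self (fun x => p x), hp.2]

/-- A functional which is at least `δ` on all probability densities is given by a function which is
at least `δ`. -/
theorem ae_le_of_forall_probabilityDensities [SigmaFinite μ] (F : Lp ℝ ∞ μ) (δ : ℝ)
    (h : ∀ p ∈ probabilityDensities μ, δ ≤ linftyToDual μ F p) : ∀ᵐ x ∂μ, δ ≤ F x := by
  refine ae_le_of_le_linftyToDual F δ fun A hA hμA => ?_
  rcases eq_or_ne (μ A) 0 with h0 | h0
  · rw [linftyToDual_indicator, Measure.restrict_eq_zero.2 h0, measureReal_def, h0]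
    simp
  have hpos : 0 < μ.real A := ENNReal.toReal_pos h0 hμA
  have hn := normalizedIndicator_ae (ν := μ) hA hμA
  have hp : normalizedIndicator μ hA hμA ∈ probabilityDensities μ := by
    refine ⟨?_, integral_normalizedIndicator hA hμA h0⟩
    rw [← Lp.coeFn_nonneg]
    filter_upwards [hn] with x hx
    rw [hx]
    exact Set.indicator_nonneg (fun _ _ => inv_nonneg.2 hpos.le) x
  have h1 := h _ hp
  rw [normalizedIndicator, map_smul, smul_eq_mul, inv_mul_eq_div, le_div_iff₀ hpos] at h1
  exact h1

/-- An invariant mean on `L^∞` yields a bounded invariant functional on the dual of `L¹` which is a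
mean over the probability densities. -/
theorem HasInvariantMean.exists_functional [SigmaFinite μ] (h : HasInvariantMean G μ) :
    ∃ M : StrongDual ℝ (Lp ℝ 1 μ) →L[ℝ] ℝ,
      (∀ (ℓ : StrongDual ℝ (Lp ℝ 1 μ)) (t : G),
        M (ℓ ∘L (translationL1 G μ t).toContinuousLinearEquiv.toContinuousLinearMap) = M ℓ) ∧
      ∀ (ℓ : StrongDual ℝ (Lp ℝ 1 μ)) (δ : ℝ),
        (∀ p ∈ probabilityDensities μ, δ ≤ ℓ p) → δ ≤ M ℓ := by
  obtain ⟨m, hm0, hm1, hmG⟩ := h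
  let J : Lp ℝ ∞ μ ≃ₗ[ℝ] StrongDual ℝ (Lp ℝ 1 μ) :=
    LinearEquiv.ofBijective (linftyToDual μ).toLinearMap
      ⟨linftyToDual_injective, linftyToDual_surjective⟩
  have hJ : ∀ F, J F = linftyToDual μ F := fun F => rfl
  let c : Lp ℝ ∞ μ →L[ℝ] Lp ℂ ∞ μ := Complex.ofRealCLM.compLpL ∞ μ
  have hc : ∀ F, c F =ᵐ[μ] fun x => ((F x : ℝ) : ℂ) := fun F =>
    ContinuousLinearMap.coeFn_compLpL _ _
  let M₀ : StrongDual ℝ (Lp ℝ 1 μ) →ₗ[ℝ] ℝ :=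
    Complex.reLm ∘ₗ m.restrictScalars ℝ ∘ₗ c.toLinearMap ∘ₗ J.symm.toLinearMap
  have hM₀ : ∀ F, M₀ (J F) = (m (c F)).re := fun F => by
    simp [M₀]
  have hlow : ∀ (ℓ : StrongDual ℝ (Lp ℝ 1 μ)) (δ : ℝ),
      (∀ p ∈ probabilityDensities μ, δ ≤ ℓ p) → δ ≤ M₀ ℓ := by
    intro ℓ δ hℓ
    obtain ⟨F, rfl⟩ := J.surjective ℓ
    have hF := ae_le_of_forall_probabilityDensities F δ hℓ
    set e : Lp ℂ ∞ μ := (memLp_top_const (1 : ℂ)).toLp (fun _ => 1) with he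
    have h1 : 0 ≤ m (c F - (δ : ℂ) • e) := by
      refine hm0 _ ?_
      filter_upwards [hF, hc F, Lp.coeFn_sub (c F) ((δ : ℂ) • e), Lp.coeFn_smul (δ : ℂ) e,
        (memLp_top_const (μ := μ) (1 : ℂ)).coeFn_toLp] with x h1 h2 h3 h4 h5
      rw [h3, Pi.sub_apply, h2, h4, Pi.smul_apply, h5, smul_eq_mul, mul_one, sub_nonneg]
      exact_mod_cast h1
    rw [map_sub, map_smul, hm1, smul_eq_mul, mul_one] at h1
    have h2 := (Complex.le_def.1 h1).1
    rw [hM₀]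
    simpa using h2
  have hbound : ∀ ℓ, ‖M₀ ℓ‖ ≤ 1 * ‖ℓ‖ := by
    intro ℓ
    have h1 : ∀ ℓ : StrongDual ℝ (Lp ℝ 1 μ), -‖ℓ‖ ≤ M₀ ℓ := fun ℓ => by
      refine hlow ℓ _ fun p hp => ?_
      have := ℓ.le_opNorm p
      rw [norm_eq_one_of_mem_probabilityDensities hp, mul_one, Real.norm_eq_abs] at this
      exact (abs_le.1 this).1
    have h2 := h1 (-ℓ)
    rw [norm_neg, map_neg] at h2
    rw [one_mul, Real.norm_eq_abs]
    exact abs_le.2 ⟨h1 ℓ, by linarith⟩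
  refine ⟨M₀.mkContinuous 1 hbound, fun ℓ t => ?_, hlow⟩
  obtain ⟨F, rfl⟩ := J.surjective ℓ
  rw [hJ, linftyToDual_comp_translation, ← hJ, ← hJ, LinearMap.mkContinuous_apply,
    LinearMap.mkContinuous_apply, hM₀, hM₀]
  have h1 : c (DomMulAct.mk t • F) = DomMulAct.mk (t⁻¹)⁻¹ • c F := by
    rw [inv_inv]
    refine Lp.ext ?_
    have h2 := (measurePreserving_smul t μ).quasiMeasurePreserving.ae (hc F)
    filter_upwards [h2, hc (DomMulAct.mk t • F), DomMulAct.smul_Lp_ae_eq (DomMulAct.mk t) F,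
      DomMulAct.smul_Lp_ae_eq (DomMulAct.mk t) (c F)] with x h2 h3 h4 h5
    rw [h3, h4, h5]
    exact h2.symm
  rw [h1, hmG]

theorem norm_sq_eq_integral_L2 (f : Lp ℂ 2 μ) : ‖f‖ ^ 2 = ∫ x, ‖f x‖ ^ 2 ∂μ := by
  have h1 := inner_self_eq_norm_sq_to_K (𝕜 := ℂ) f
  rw [L2.inner_def] at h1
  simp_rw [inner_self_eq_norm_sq_to_K] at h1
  have h2 : ∫ x, ((‖f x‖ : ℝ) : ℂ) ^ 2 ∂μ = ((∫ x, ‖f x‖ ^ 2 ∂μ : ℝ) : ℂ) := by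
    rw [← integral_complex_ofReal]
    simp
  have h3 := h1.symm.trans h2
  norm_cast at h3
  exact Complex.ofReal_injective h3

theorem sq_sqrt_sub_sqrt_le {a b : ℝ} (ha : 0 ≤ a) (hb : 0 ≤ b) : (√a - √b) ^ 2 ≤ |a - b| := by
  have h1 : a - b = (√a - √b) * (√a + √b) := by
    have := Real.sq_sqrt ha
    have := Real.sq_sqrt hb
    ring_nf
    linarith
  rw [h1, abs_mul, ← sq_abs, sq]
  refine mul_le_mul_of_nonneg_left ?_ (abs_nonneg _)
  rw [abs_of_nonneg (add_nonneg (Real.sqrt_nonneg a) (Real.sqrt_nonneg b)), abs_le]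
  constructor <;> linarith [Real.sqrt_nonneg a, Real.sqrt_nonneg b]

/-- The square root of an almost invariant probability density is an almost invariant unit vector
of `L²`. -/
theorem exists_sqrt_L2 {p : Lp ℝ 1 μ} (hp : p ∈ probabilityDensities μ) :
    ∃ ξ : Lp ℂ 2 μ, ‖ξ‖ = 1 ∧
      ∀ g : G, ‖permRep G μ g ξ - ξ‖ ^ 2 ≤ ‖translationL1 G μ g p - p‖ := by
  have hp0 := (Lp.coeFn_nonneg p).2 hp.1
  have hm : AEStronglyMeasurable (fun x => ((√(p x) : ℝ) : ℂ)) μ :=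
    Complex.continuous_ofReal.comp_aestronglyMeasurable
      (Real.continuous_sqrt.comp_aestronglyMeasurable (Lp.aestronglyMeasurable p))
  have hsq : ∀ᵐ x ∂μ, ‖((√(p x) : ℝ) : ℂ)‖ ^ 2 = p x := by
    filter_upwards [hp0] with x hx
    rw [Complex.norm_real, Real.norm_of_nonneg (Real.sqrt_nonneg _), Real.sq_sqrt hx]
  have hL : MemLp (fun x => ((√(p x) : ℝ) : ℂ)) 2 μ := by
    rw [memLp_two_iff_integrable_sq_norm hm]
    exact (L1.integrable_coeFn p).congr (hsq.mono fun x hx => hx.symm)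
  refine ⟨hL.toLp _, ?_, fun g => ?_⟩
  · have h1 : ‖hL.toLp _‖ ^ 2 = 1 := by
      rw [norm_sq_eq_integral_L2, ← hp.2]
      refine integral_congr_ae ?_
      filter_upwards [hL.coeFn_toLp, hsq] with x h1 h2
      rw [h1, h2]
    exact (pow_eq_one_iff_of_nonneg (norm_nonneg _) two_ne_zero).1 h1
  · rw [norm_sq_eq_integral_L2, L1.norm_eq_integral_norm]
    have hint : Integrable (fun x => ‖(permRep G μ g (hL.toLp _) - hL.toLp _ : Lp ℂ 2 μ) x‖ ^ 2) μ :=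
      (memLp_two_iff_integrable_sq_norm (Lp.aestronglyMeasurable _)).1 (Lp.memLp _)
    refine integral_mono_ae hint (L1.integrable_coeFn _).norm ?_
    have hq := (measurePreserving_smul g⁻¹ μ).quasiMeasurePreserving
    filter_upwards [hL.coeFn_toLp, hq.ae hL.coeFn_toLp, hp0, hq.ae hp0, permRep_apply_ae G μ g
      (hL.toLp _), translationL1_ae μ g p, Lp.coeFn_sub (permRep G μ g (hL.toLp _)) (hL.toLp _),
      Lp.coeFn_sub (translationL1 G μ g p) p] with x h1 h2 h3 h4 h5 h6 h7 h8
    rw [h7, h8, Pi.sub_apply, Pi.sub_apply, h5, h6, h1, h2, ← Complex.ofReal_sub,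
      Complex.norm_real, Real.norm_eq_abs, Real.norm_eq_abs, sq_abs]
    exact sq_sqrt_sub_sqrt_le h4 h3

theorem isPositiveDefinite_coefficient (ξ : Lp ℂ 2 μ) :
    IsPositiveDefinite fun g : G => inner ℂ (permRep G μ g ξ) ξ := by
  intro n g
  have h1 := (Matrix.posSemidef_gram ℂ fun i => permRep G μ (g i) ξ).transpose
  convert! h1 using 1
  ext i j
  have h2 : permRep G μ (g i) (permRep G μ ((g i)⁻¹ * g j) ξ) = permRep G μ (g j) ξ := by
    have h3 := map_mul (permRep G μ) (g i) ((g i)⁻¹ * g j)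
    rw [mul_inv_cancel_left] at h3
    rw [h3]
    rfl
  rw [Matrix.of_apply, Matrix.transpose_apply, Matrix.gram_apply, ← h2,
    LinearIsometryEquiv.inner_map_map]

variable [TopologicalSpace G] [IsTopologicalGroup G] [LocallyCompactSpace G]
  [SecondCountableTopology G]

/-- A `C₀`-representation by translations with almost invariant unit vectors gives the Haagerup
property, through its diagonal coefficients. -/
theorem hasHaagerupProperty_of_almost_invariant (hC : PermRepVanishesAtInfinity G μ)
    (hc : IsContinuousPermRep G μ)
    (h : ∀ K : Set G, IsCompact K → ∀ ε > 0, ∃ ξ : Lp ℂ 2 μ, ‖ξ‖ = 1 ∧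
      ∀ g ∈ K, ‖permRep G μ g ξ - ξ‖ ≤ ε) : HasHaagerupProperty G := by
  let K := CompactExhaustion.choice G
  choose ξ hξ1 hξ using fun n : ℕ => h (K n) (K.isCompact n) (1 / ((n : ℝ) + 1)) (by positivity)
  refine ⟨fun n => ⟨⟨fun g => inner ℂ (permRep G μ g (ξ n)) (ξ n),
    (hc (ξ n)).inner continuous_const⟩, hC (ξ n) (ξ n)⟩, fun n => ?_, fun n => ?_,
    fun L hL => ?_⟩
  · exact isPositiveDefinite_coefficient (ξ n)
  · change inner ℂ (permRep G μ 1 (ξ n)) (ξ n) = 1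
    rw [map_one, LinearIsometryEquiv.coe_one, id, inner_self_eq_norm_sq_to_K, hξ1]
    simp
  · rw [Metric.tendstoUniformlyOn_iff]
    intro ε hε
    obtain ⟨N, hN⟩ := K.exists_superset_of_isCompact hL
    obtain ⟨N', hN'⟩ := exists_nat_one_div_lt hε
    filter_upwards [eventually_ge_atTop (max N N')] with n hn g hg
    have h1 : (1 : ℂ) = inner ℂ (ξ n) (ξ n) := by
      rw [inner_self_eq_norm_sq_to_K, hξ1]
      simp
    change dist (1 : ℂ) (inner ℂ (permRep G μ g (ξ n)) (ξ n)) < ε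
    rw [dist_comm, h1, dist_eq_norm, ← inner_sub_left]
    refine (norm_inner_le_norm _ _).trans_lt ?_
    rw [hξ1, mul_one]
    refine (hξ n g (K.subset ((le_max_left _ _).trans hn) (hN hg))).trans_lt (lt_of_le_of_lt ?_ hN')
    have : (N' : ℝ) ≤ n := by exact_mod_cast (le_max_right _ _).trans hn
    gcongr

/-- A σ-finite, strongly continuous `C₀`-dynamical system with an invariant mean forces the Haagerup
property. -/
theorem IsC0DynamicalSystem.hasHaagerupProperty [SigmaFinite μ] (hC : IsC0DynamicalSystem G μ)
    (hc : IsContinuousPermRep G μ) (hm : HasInvariantMean G μ) : HasHaagerupProperty G := by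
  refine hasHaagerupProperty_of_almost_invariant hC.permRepVanishesAtInfinity hc
    fun K hK ε hε => ?_
  borelize G
  obtain ⟨M, hM, hMP⟩ := hm.exists_functional
  obtain ⟨p, hp, hpK⟩ := exists_almost_invariant_of_invariant_mean (translationL1 G μ)
    (fun f => continuous_smul_Lp f (tendsto_smul_Lp_sub_self ENNReal.one_ne_top
      (fun A hA hμA => tendsto_measure_smul_symmDiff hc hA hμA) f))
    M hM convex_probabilityDensities isClosed_probabilityDensities
    (fun t p hp => translationL1_mem_probabilityDensities t hp)
    (fun p hp => (norm_eq_one_of_mem_probabilityDensities hp).le) hMP hK (pow_pos hε 2)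
  obtain ⟨ξ, hξ1, hξ⟩ := exists_sqrt_L2 (G := G) hp
  exact ⟨ξ, hξ1, fun g hg => le_of_sq_le_sq ((hξ g).trans (hpK g hg)) hε.le⟩

end InvariantMean

/-! ### Gaussian random fields indexed by a Hilbert space -/

section Gaussian

open ProbabilityTheory

/-- An isonormal Gaussian field: a linear isometric embedding `Φ` of `H` into the real `L²` space of
a probability measure, such that `Φ v` is centred Gaussian with variance `‖v‖²`. It is enough to
prescribe the characteristic function of `Φ v` at `1`, since `v` may be rescaled. -/
structure IsIsonormal {H X : Type*} [NormedAddCommGroup H] [InnerProductSpace ℝ H]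
    [MeasurableSpace X] (P : Measure X) (Φ : H →ₗᵢ[ℝ] Lp ℝ 2 P) : Prop where
  integral_exp : ∀ v, ∫ ω, Complex.exp ((Φ v ω : ℝ) * Complex.I) ∂P =
    Complex.exp (-(‖v‖ ^ 2 : ℝ) / 2)

theorem norm_exp_mul_I_sub_le (a b : ℝ) :
    ‖Complex.exp (a * Complex.I) - Complex.exp (b * Complex.I)‖ ≤ |a - b| := by
  have h1 : Complex.exp (a * Complex.I) - Complex.exp (b * Complex.I) =
      Complex.exp (b * Complex.I) * (Complex.exp (Complex.I * ((a - b : ℝ) : ℂ)) - 1) := by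
    rw [mul_sub, ← Complex.exp_add, mul_one]
    congr 2
    push_cast
    ring
  rw [h1, norm_mul, Complex.norm_exp_ofReal_mul_I, one_mul]
  exact Real.norm_exp_I_mul_ofReal_sub_one_le

theorem integral_abs_le_norm_L2 {X : Type*} [MeasurableSpace X] {P : Measure X}
    [IsProbabilityMeasure P] (f : Lp ℝ 2 P) : ∫ ω, |f ω| ∂P ≤ ‖f‖ := by
  have h1 : eLpNorm f 1 P ≤ eLpNorm f 2 P :=
    eLpNorm_le_eLpNorm_of_exponent_le (by norm_num) (Lp.aestronglyMeasurable f)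
  have h2 := ENNReal.toReal_mono (Lp.eLpNorm_ne_top f) h1
  rw [← Lp.norm_def, eLpNorm_one_eq_lintegral_enorm,
    ← integral_norm_eq_lintegral_enorm (Lp.aestronglyMeasurable f)] at h2
  exact h2

theorem continuous_integral_exp_L2 {X : Type*} [MeasurableSpace X] (P : Measure X)
    [IsProbabilityMeasure P] :
    Continuous fun f : Lp ℝ 2 P => ∫ ω, Complex.exp ((f ω : ℝ) * Complex.I) ∂P := by
  have hint : ∀ f : Lp ℝ 2 P, Integrable (fun ω => Complex.exp ((f ω : ℝ) * Complex.I)) P := by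
    intro f
    refine (integrable_const (1 : ℝ)).mono' ?_ (Eventually.of_forall fun ω => ?_)
    · exact (by fun_prop : Continuous fun x : ℝ => Complex.exp ((x : ℂ) * Complex.I)
        ).comp_aestronglyMeasurable (Lp.aestronglyMeasurable f)
    · rw [Complex.norm_exp_ofReal_mul_I]
  refine LipschitzWith.continuous (K := 1) (LipschitzWith.of_dist_le_mul fun f g => ?_)
  rw [NNReal.coe_one, one_mul, dist_eq_norm, dist_eq_norm, ← integral_sub (hint f) (hint g)]
  refine (norm_integral_le_integral_norm _).trans ?_
  refine le_trans ?_ (integral_abs_le_norm_L2 (f - g))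
  refine integral_mono_ae ((hint f).sub (hint g)).norm
    ((Lp.memLp (f - g)).integrable (by norm_num)).abs ?_
  filter_upwards [Lp.coeFn_sub f g] with ω hω
  rw [hω]
  exact norm_exp_mul_I_sub_le _ _

/-- The characteristic function of a linear combination of independent standard Gaussian
variables. -/
theorem integral_exp_sum_infinitePi {ι : Type*} (s : Finset ι) (a : ι → ℝ) :
    ∫ x : ι → ℝ, Complex.exp ((∑ i ∈ s, a i * x i : ℝ) * Complex.I)
      ∂(Measure.infinitePi fun _ : ι => gaussianReal 0 1) =
      Complex.exp (-(∑ i ∈ s, a i ^ 2 : ℝ) / 2) := by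
  have h1 : ∀ x : ι → ℝ, Complex.exp ((∑ i ∈ s, a i * x i : ℝ) * Complex.I) =
      (fun y : s → ℝ => ∏ i : s, Complex.exp ((a i : ℂ) * (y i : ℂ) * Complex.I)) (s.restrict x) :=
    fun x => by
      simp only [Finset.restrict]
      rw [Finset.prod_coe_sort s fun i => Complex.exp ((a i : ℂ) * (x i : ℂ) * Complex.I),
        ← Complex.exp_sum, ← Finset.sum_mul]
      push_cast
      rfl
  rw [integral_congr_ae (Eventually.of_forall h1)]
  refine (integral_restrict_infinitePi (X := fun _ : ι => ℝ) (μ := fun _ => gaussianReal 0 1)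
    (f := fun y : s → ℝ => ∏ i : s, Complex.exp ((a i : ℂ) * (y i : ℂ) * Complex.I))
    (Continuous.aestronglyMeasurable (by fun_prop))).trans ?_
  rw [integral_fintype_prod_eq_prod (f := fun (i : s) (x : ℝ) =>
      Complex.exp ((a i : ℂ) * (x : ℂ) * Complex.I))]
  simp_rw [← charFun_apply_real, charFun_gaussianReal]
  rw [Finset.prod_coe_sort s fun i => Complex.exp ((a i : ℂ) * ((0 : ℝ) : ℂ) * Complex.I -
    ((1 : NNReal) : ℂ) * (a i : ℂ) ^ 2 / 2), ← Complex.exp_sum]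
  congr 1
  push_cast
  rw [neg_div, Finset.sum_div, ← Finset.sum_neg_distrib]
  refine Finset.sum_congr rfl fun i _ => ?_
  ring

/-- Every Hilbert space carries an isonormal Gaussian field: send an orthonormal basis to
independent standard Gaussian variables. -/
theorem exists_isIsonormal (H : Type*) [NormedAddCommGroup H] [InnerProductSpace ℝ H]
    [CompleteSpace H] :
    ∃ (w : Set H) (P : Measure (w → ℝ)) (_ : IsProbabilityMeasure P) (Φ : H →ₗᵢ[ℝ] Lp ℝ 2 P),
      IsIsonormal P Φ := by
  classical
  obtain ⟨w, e, -⟩ := exists_hilbertBasis ℝ H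
  let P : Measure (w → ℝ) := Measure.infinitePi fun _ => gaussianReal 0 1
  have hmap : ∀ i : w, P.map (fun x => x i) = gaussianReal 0 1 := fun i =>
    Measure.infinitePi_map_eval _ i
  have hmem : ∀ i : w, MemLp (fun x : w → ℝ => x i) 2 P := fun i => by
    have h1 : MemLp (id : ℝ → ℝ) 2 (P.map fun x => x i) := by
      rw [hmap]
      exact memLp_id_gaussianReal 2
    exact (memLp_map_measure_iff (g := id) (by fun_prop)
      (measurable_pi_apply i).aemeasurable).1 h1
  have hindep : iIndepFun (fun (i : w) (x : w → ℝ) => x i) P :=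
    iIndepFun_infinitePi (X := fun _ x => x) (fun _ => measurable_id)
  have hinner : ∀ i j : w, inner ℝ ((hmem i).toLp _) ((hmem j).toLp _) =
      ∫ x, x i * x j ∂P := fun i j => by
    rw [L2.inner_def]
    refine integral_congr_ae ?_
    filter_upwards [(hmem i).coeFn_toLp, (hmem j).coeFn_toLp] with x h1 h2
    rw [h1, h2]
    simp [mul_comm]
  have hmean : ∀ i : w, ∫ x, x i ∂P = 0 := fun i => by
    have h1 : ∫ x, id x ∂(P.map fun x => x i) = ∫ x, x i ∂P :=
      integral_map (measurable_pi_apply i).aemeasurable (by fun_prop)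
    rw [← h1, hmap]
    exact integral_id_gaussianReal
  have hvar : ∀ i : w, ∫ x, x i * x i ∂P = 1 := fun i => by
    have h1 : ∫ x, x ^ 2 ∂(P.map fun x => x i) = ∫ x, x i ^ 2 ∂P :=
      integral_map (measurable_pi_apply i).aemeasurable (by fun_prop)
    simp_rw [← sq]
    rw [← h1, hmap]
    have h2 := variance_id_gaussianReal (μ := 0) (v := 1)
    rw [variance_of_integral_eq_zero (X := id) (by fun_prop) integral_id_gaussianReal] at h2
    simpa using h2
  have hortho : Orthonormal ℝ fun i : w => (hmem i).toLp (fun x : w → ℝ => x i) := by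
    rw [orthonormal_iff_ite]
    intro i j
    rw [hinner]
    split_ifs with h
    · rw [h, hvar]
    · rw [(hindep.indepFun h).integral_fun_mul_eq_mul_integral
        (hmem i).aestronglyMeasurable (hmem j).aestronglyMeasurable, hmean, zero_mul]
  let Φ : H →ₗᵢ[ℝ] Lp ℝ 2 P :=
    hortho.orthogonalFamily.linearIsometry.comp e.repr.toLinearIsometry
  have hΦ : ∀ i, Φ (e i) = (hmem i).toLp _ := fun i => by
    change hortho.orthogonalFamily.linearIsometry (e.repr (e i)) = _
    rw [e.repr_self, OrthogonalFamily.linearIsometry_apply_single]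
    simp
  refine ⟨w, P, inferInstance, Φ, ⟨fun v => ?_⟩⟩
  have hclosed : IsClosed {v : H | ∫ ω, Complex.exp ((Φ v ω : ℝ) * Complex.I) ∂P =
      Complex.exp (-(‖v‖ ^ 2 : ℝ) / 2)} :=
    isClosed_eq ((continuous_integral_exp_L2 P).comp Φ.continuous) (by fun_prop)
  have hv : v ∈ (Submodule.span ℝ (Set.range e)).topologicalClosure := by
    rw [e.dense_span]
    trivial
  refine closure_minimal (fun v hv => ?_) hclosed hv
  obtain ⟨c, rfl⟩ := Finsupp.mem_span_range_iff_exists_finsupp.1 hv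
  have h1 : Φ (c.sum fun i a => a • e i) =ᵐ[P] fun x => ∑ i ∈ c.support, c i * x i := by
    rw [Finsupp.sum, map_sum]
    refine (Lp.coeFn_fun_finsetSum _ _).trans ?_
    have h2 : ∀ i, Φ (c i • e i) =ᵐ[P] fun x => c i * x i := fun i => by
      rw [map_smul, hΦ]
      filter_upwards [Lp.coeFn_smul (c i) ((hmem i).toLp _), (hmem i).coeFn_toLp] with x h1 h2
      rw [h1, Pi.smul_apply, h2, smul_eq_mul]
    have h3 : ∀ᵐ x ∂P, ∀ i ∈ c.support, Φ (c i • e i) x = c i * x i :=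
      (ae_ball_iff c.support.countable_toSet).2 fun i _ => h2 i
    filter_upwards [h3] with x hx
    exact Finset.sum_congr rfl hx
  have h2 : ‖c.sum fun i a => a • e i‖ ^ 2 = ∑ i ∈ c.support, c i ^ 2 := by
    rw [← real_inner_self_eq_norm_sq, Finsupp.sum, e.orthonormal.inner_sum]
    simp [sq]
  rw [Set.mem_ofPred_eq, h2, ← integral_exp_sum_infinitePi]
  refine integral_congr_ae ?_
  filter_upwards [h1] with x hx
  rw [hx]

end Gaussian

section GaussianLaw

open ProbabilityTheory

variable {H X : Type*} [NormedAddCommGroup H] [InnerProductSpace ℝ H] [MeasurableSpace X]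
  {P : Measure X} [IsProbabilityMeasure P] {Φ : H →ₗᵢ[ℝ] Lp ℝ 2 P}

omit [IsProbabilityMeasure P] in
theorem measurable_isonormal (Φ : H →ₗᵢ[ℝ] Lp ℝ 2 P) (v : H) : Measurable (Φ v) :=
  (Lp.stronglyMeasurable _).measurable

/-- The law of the field along a family of vectors depends only on their Gram matrix. -/
theorem IsIsonormal.map_eq_of_inner_eq (hΦ : IsIsonormal P Φ) {T : Type*} (β β' : T → H)
    (h : ∀ s t, inner ℝ (β s) (β t) = inner ℝ (β' s) (β' t)) :
    P.map (fun ω t => Φ (β t) ω) = P.map (fun ω t => Φ (β' t) ω) := by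
  have hm : ∀ β : T → H, Measurable fun ω t => Φ (β t) ω := fun β =>
    measurable_pi_lambda _ fun t => measurable_isonormal Φ _
  refine (map_eq_iff_forall_finset_map_restrict_eq (X := fun t ω => Φ (β t) ω)
    (Y := fun t ω => Φ (β' t) ω) (hm β).aemeasurable (hm β').aemeasurable).2 fun I => ?_
  have hI : ∀ β : T → H, Measurable fun ω => I.restrict fun t => Φ (β t) ω := fun β =>
    (Finset.measurable_restrict I).comp (hm β)
  have : IsProbabilityMeasure (P.map fun ω => I.restrict fun t => Φ (β t) ω) :=
    Measure.isProbabilityMeasure_map (hI β).aemeasurable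
  have : IsProbabilityMeasure (P.map fun ω => I.restrict fun t => Φ (β' t) ω) :=
    Measure.isProbabilityMeasure_map (hI β').aemeasurable
  classical
  have key : ∀ (β : T → H) (L : StrongDual ℝ (I → ℝ)),
      charFunDual (P.map fun ω => I.restrict fun t => Φ (β t) ω) L =
        Complex.exp (-(∑ i : I, ∑ j : I, L (Pi.single i 1) * L (Pi.single j 1) *
          inner ℝ (β i) (β j) : ℝ) / 2) := by
    intro β L
    rw [charFunDual_apply, integral_map (hI β).aemeasurable
      (Continuous.aestronglyMeasurable (by fun_prop))]
    have h1 : Φ (∑ i : I, L (Pi.single i 1) • β i) =ᵐ[P]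
        fun ω => L (I.restrict fun t => Φ (β t) ω) := by
      rw [map_sum]
      refine (Lp.coeFn_fun_finsetSum _ _).trans ?_
      have h2 : ∀ᵐ ω ∂P, ∀ i : I,
          Φ (L (Pi.single i 1) • β i) ω = L (Pi.single i 1) * Φ (β i) ω := by
        refine ae_all_iff.2 fun i => ?_
        rw [map_smul]
        filter_upwards [Lp.coeFn_smul (L (Pi.single i 1)) (Φ (β i))] with ω hω
        rw [hω, Pi.smul_apply, smul_eq_mul]
      filter_upwards [h2] with ω hω
      have h3 : (I.restrict fun t => Φ (β t) ω) =
          ∑ i : I, (Φ (β i) ω) • (Pi.single i 1 : I → ℝ) := by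
        ext j
        simp [Finset.sum_apply, Pi.single_apply]
      rw [h3, map_sum]
      refine Finset.sum_congr rfl fun i _ => ?_
      rw [hω, map_smul, smul_eq_mul, mul_comm]
    have h4 : ‖∑ i : I, L (Pi.single i 1) • β i‖ ^ 2 =
        ∑ i : I, ∑ j : I, L (Pi.single i 1) * L (Pi.single j 1) * inner ℝ (β i) (β j) := by
      rw [← real_inner_self_eq_norm_sq, sum_inner]
      refine Finset.sum_congr rfl fun i _ => ?_
      rw [inner_sum]
      refine Finset.sum_congr rfl fun j _ => ?_
      rw [real_inner_smul_left, real_inner_smul_right, mul_assoc]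
    rw [← h4, ← hΦ.integral_exp]
    refine integral_congr_ae ?_
    filter_upwards [h1] with ω hω
    rw [hω]
  refine Measure.ext_of_charFunDual (funext fun L => ?_)
  rw [key, key]
  simp_rw [h]

theorem IsIsonormal.map_eq_gaussianReal (hΦ : IsIsonormal P Φ) (v : H) :
    P.map (Φ v) = gaussianReal 0 (‖v‖₊ ^ 2) := by
  have hm := measurable_isonormal Φ v
  have : IsProbabilityMeasure (P.map (Φ v)) := Measure.isProbabilityMeasure_map hm.aemeasurable
  refine Measure.ext_of_charFun (funext fun t => ?_)
  rw [charFun_apply_real, integral_map hm.aemeasurable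
    (Continuous.aestronglyMeasurable (by fun_prop)), charFun_gaussianReal]
  have h1 := hΦ.integral_exp (t • v)
  rw [norm_smul, mul_pow, Real.norm_eq_abs, sq_abs] at h1
  have h2 : ∫ ω, Complex.exp ((Φ (t • v) ω : ℝ) * Complex.I) ∂P =
      ∫ ω, Complex.exp ((t : ℂ) * (Φ v ω : ℝ) * Complex.I) ∂P := by
    refine integral_congr_ae ?_
    rw [map_smul]
    filter_upwards [Lp.coeFn_smul t (Φ v)] with ω hω
    rw [hω, Pi.smul_apply, smul_eq_mul]
    push_cast
    rfl
  rw [← h2, h1]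
  congr 1
  push_cast
  ring

/-- Small ball estimate: a Gaussian variable of large variance is rarely small. -/
theorem IsIsonormal.measure_abs_lt_le (hΦ : IsIsonormal P Φ) {v : H} (hv : v ≠ 0) (r : ℝ) :
    P {ω | |Φ v ω| < r} ≤ ENNReal.ofReal (2 * r / ‖v‖) := by
  have hv' : 0 < ‖v‖ := norm_pos_iff.2 hv
  have hv0 : ‖v‖₊ ^ 2 ≠ 0 := by simpa using hv
  have h1 : {ω | |Φ v ω| < r} = Φ v ⁻¹' Set.Ioo (-r) r := by
    ext ω
    simp [abs_lt]
  rw [h1, ← Measure.map_apply (measurable_isonormal Φ v) measurableSet_Ioo,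
    hΦ.map_eq_gaussianReal, gaussianReal_apply _ hv0]
  have h2 : ∀ x, gaussianPDF 0 (‖v‖₊ ^ 2) x ≤ ENNReal.ofReal (‖v‖⁻¹) := fun x => by
    rw [gaussianPDF, gaussianPDFReal]
    refine ENNReal.ofReal_le_ofReal ?_
    have h3 : Real.exp (-(x - 0) ^ 2 / (2 * ((‖v‖₊ ^ 2 : NNReal) : ℝ))) ≤ 1 := by
      rw [Real.exp_le_one_iff, neg_div]
      exact neg_nonpos.2 (by positivity)
    have h4 : ‖v‖ ≤ √(2 * Real.pi * ((‖v‖₊ ^ 2 : NNReal) : ℝ)) := by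
      refine Real.le_sqrt_of_sq_le ?_
      push_cast
      nlinarith [Real.pi_gt_three, sq_nonneg ‖v‖]
    calc _ ≤ (√(2 * Real.pi * ((‖v‖₊ ^ 2 : NNReal) : ℝ)))⁻¹ * 1 := by gcongr
      _ ≤ ‖v‖⁻¹ := by
        rw [mul_one]
        exact inv_anti₀ hv' h4
  calc ∫⁻ x in Set.Ioo (-r) r, gaussianPDF 0 (‖v‖₊ ^ 2) x
      ≤ ∫⁻ x in Set.Ioo (-r) r, ENNReal.ofReal (‖v‖⁻¹) := lintegral_mono fun x => h2 x
    _ = ENNReal.ofReal (‖v‖⁻¹) * ENNReal.ofReal (2 * r) := by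
        rw [setLIntegral_const, Real.volume_Ioo]
        congr 2
        ring
    _ = ENNReal.ofReal (2 * r / ‖v‖) := by
        rw [← ENNReal.ofReal_mul (by positivity)]
        congr 1
        ring

end GaussianLaw

/-! ### The space of paths and the random shift measure -/

section PathSpace

/-- The space of all real functions on `G`, with the product σ-algebra and the action of `G` by
translations `(h • y)(g) = y (h⁻¹ g)`. -/
def PathSpace (G : Type u) : Type u := G → ℝ

instance (G : Type u) : MeasurableSpace (PathSpace G) := inferInstanceAs (MeasurableSpace (G → ℝ))

variable {G : Type u} [Group G]

instance : MulAction G (PathSpace G) where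
  smul h y := fun g => y (h⁻¹ * g)
  one_smul y := funext fun g => by
    change y (1⁻¹ * g) = y g
    rw [inv_one, one_mul]
  mul_smul h k y := funext fun g => by
    change y ((h * k)⁻¹ * g) = y (k⁻¹ * (h⁻¹ * g))
    rw [mul_inv_rev, mul_assoc]

theorem pathSpace_smul_apply (h : G) (y : PathSpace G) (g : G) : (h • y) g = y (h⁻¹ * g) := rfl

instance : MeasurableConstSMul G (PathSpace G) where
  measurable_const_smul h := measurable_pi_lambda _ fun g => measurable_pi_apply (h⁻¹ * g)

/-- The set of paths whose value at `g` lies in the open interval `(a, b)`. -/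
def window (g : G) (a b : ℝ) : Set (PathSpace G) := {y | y g ∈ Set.Ioo a b}

omit [Group G] in
theorem measurableSet_window (g : G) (a b : ℝ) : MeasurableSet (window g a b) :=
  (measurable_pi_apply (X := fun _ : G => ℝ) g) measurableSet_Ioo

theorem smul_window (h g : G) (a b : ℝ) : h • window g a b = window (h * g) a b := by
  ext y
  rw [Set.mem_smul_set_iff_inv_smul_mem]
  simp [window, pathSpace_smul_apply]

variable {X : Type*} [MeasurableSpace X] {P : Measure X}

/-- The random path `g ↦ t + W g ω`, as a function of the pair `(ω, t)`. -/
def shiftedPath (W : G → X → ℝ) (p : X × ℝ) : PathSpace G := fun g => p.2 + W g p.1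

/-- The law of the random path `g ↦ t + W g`, where `t` is distributed according to Lebesgue
measure and independent of `W`. -/
noncomputable def shiftedLaw (P : Measure X) (W : G → X → ℝ) : Measure (PathSpace G) :=
  (P.prod volume).map (shiftedPath W)

omit [Group G] in
theorem measurable_shiftedPath {W : G → X → ℝ} (hW : ∀ g, Measurable (W g)) :
    Measurable (shiftedPath W) :=
  measurable_pi_lambda _ fun g => measurable_snd.add ((hW g).comp measurable_fst)

omit [Group G] in
/-- Adding a random constant to `W` does not change the shifted law, by translation invariance of
Lebesgue measure. -/
theorem shiftedLaw_add [SFinite P] {W : G → X → ℝ} (hW : ∀ g, Measurable (W g)) {c : X → ℝ}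
    (hc : Measurable c) : shiftedLaw P (fun g ω => c ω + W g ω) = shiftedLaw P W := by
  have h1 : MeasurePreserving (fun p : X × ℝ => (p.1, p.2 + c p.1)) (P.prod volume)
      (P.prod volume) :=
    (MeasurePreserving.id P).skew_product (g := fun ω t => t + c ω)
      (measurable_snd.add (hc.comp measurable_fst))
      (Eventually.of_forall fun ω => map_add_right_eq_self volume (c ω))
  have h2 : shiftedPath (fun g ω => c ω + W g ω) =
      shiftedPath W ∘ fun p : X × ℝ => (p.1, p.2 + c p.1) := by
    funext p g
    exact (add_assoc _ _ _).symm
  rw [shiftedLaw, shiftedLaw, h2, ← Measure.map_map (measurable_shiftedPath hW) h1.measurable,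
    h1.map_eq]

omit [Group G] in
/-- The shifted law of `W` is determined by the law of `W`. -/
theorem shiftedLaw_congr [SFinite P] {W W' : G → X → ℝ} (hW : ∀ g, Measurable (W g))
    (hW' : ∀ g, Measurable (W' g))
    (h : P.map (fun ω g => W g ω) = P.map (fun ω g => W' g ω)) :
    shiftedLaw P W = shiftedLaw P W' := by
  have key : ∀ W : G → X → ℝ, (∀ g, Measurable (W g)) → shiftedLaw P W =
      ((P.map fun ω g => W g ω).prod volume).map (shiftedPath fun g (w : G → ℝ) => w g) := by
    intro W hW
    have hWm : Measurable fun ω g => W g ω := measurable_pi_lambda _ hW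
    have h1 := Measure.map_prod_map P (volume : Measure ℝ) hWm measurable_id
    rw [Measure.map_id] at h1
    rw [h1, Measure.map_map (measurable_shiftedPath measurable_pi_apply)
      (hWm.prodMap measurable_id)]
    rfl
  rw [key W hW, key W' hW', h]

omit [Group G] in
theorem shiftedLaw_apply [SFinite P] {W : G → X → ℝ} (hW : ∀ g, Measurable (W g))
    {S : Set (PathSpace G)} (hS : MeasurableSet S) :
    shiftedLaw P W S = ∫⁻ ω, volume {t : ℝ | shiftedPath W (ω, t) ∈ S} ∂P := by
  rw [shiftedLaw, Measure.map_apply (measurable_shiftedPath hW) hS,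
    Measure.prod_apply (measurable_shiftedPath hW hS)]
  rfl

/-- If the increments of `W` from a base point have a law which does not depend on the base point,
then the shifted law is invariant under translations. -/
theorem smulInvariantMeasure_shiftedLaw [SFinite P] {W : G → X → ℝ} (hW : ∀ g, Measurable (W g))
    (h : ∀ k : G, P.map (fun ω g => W (k * g) ω - W k ω) = P.map (fun ω g => W g ω - W 1 ω)) :
    SMulInvariantMeasure G (PathSpace G) (shiftedLaw P W) := by
  have hsub : ∀ k : G, shiftedLaw P (fun g ω => W (k * g) ω) = shiftedLaw P W := by
    have h1 : ∀ k : G, shiftedLaw P (fun g ω => W (k * g) ω) =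
        shiftedLaw P (fun g ω => W (k * g) ω - W k ω) := fun k => by
      rw [← shiftedLaw_add (W := fun g ω => W (k * g) ω - W k ω)
        (fun g => (hW _).sub (hW _)) (hW k)]
      simp
    intro k
    have h2 := h1 1
    simp only [one_mul] at h2
    rw [h1, h2]
    exact shiftedLaw_congr (fun g => (hW _).sub (hW _)) (fun g => (hW _).sub (hW _)) (h k)
  refine ⟨fun k S hS => ?_⟩
  rw [← Measure.map_apply (measurable_const_smul k) hS]
  congr 1
  conv_rhs => rw [← hsub k⁻¹]
  rw [shiftedLaw, Measure.map_map (measurable_const_smul k) (measurable_shiftedPath hW)]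
  rfl

omit [Group G] in
theorem shiftedLaw_window [IsProbabilityMeasure P] {W : G → X → ℝ} (hW : ∀ g, Measurable (W g))
    (g : G) (a b : ℝ) : shiftedLaw P W (window g a b) = ENNReal.ofReal (b - a) := by
  rw [shiftedLaw_apply hW (measurableSet_window g a b)]
  have h1 : ∀ ω, volume {t : ℝ | shiftedPath W (ω, t) ∈ window g a b} =
      ENNReal.ofReal (b - a) := fun ω => by
    have : {t : ℝ | shiftedPath W (ω, t) ∈ window g a b} = Set.Ioo (a - W g ω) (b - W g ω) := by
      ext t
      simp [window, shiftedPath, sub_lt_iff_lt_add, lt_sub_iff_add_lt]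
    rw [this, Real.volume_Ioo]
    congr 1
    ring
  simp_rw [h1]
  simp

omit [Group G] in
theorem shiftedLaw_symmDiff_window_le [SFinite P] {W : G → X → ℝ} (hW : ∀ g, Measurable (W g))
    (g h : G) (a b : ℝ) :
    shiftedLaw P W (symmDiff (window g a b) (window h a b)) ≤
      ∫⁻ ω, ENNReal.ofReal (2 * |W g ω - W h ω|) ∂P := by
  rw [shiftedLaw_apply hW ((measurableSet_window g a b).symmDiff (measurableSet_window h a b))]
  refine lintegral_mono fun ω => ?_
  -- `t` separates the two windows only if one of the end points lies between the two values
  have h1 : {t : ℝ | shiftedPath W (ω, t) ∈ symmDiff (window g a b) (window h a b)} ⊆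
      Set.uIcc (a - W g ω) (a - W h ω) ∪ Set.uIcc (b - W g ω) (b - W h ω) := by
    intro t ht
    simp only [window, shiftedPath, Set.mem_symmDiff, Set.mem_ofPred_eq, Set.mem_Ioo,
      not_and_or, not_lt] at ht
    simp only [Set.mem_union, Set.mem_uIcc]
    rcases ht with ⟨⟨h1, h2⟩, h3 | h3⟩ | ⟨⟨h1, h2⟩, h3 | h3⟩
    · left; left; constructor <;> linarith
    · right; right; constructor <;> linarith
    · left; right; constructor <;> linarith
    · right; left; constructor <;> linarith
  refine (measure_mono h1).trans ((measure_union_le _ _).trans_eq ?_)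
  rw [Real.volume_interval, Real.volume_interval, ← ENNReal.ofReal_add (abs_nonneg _) (abs_nonneg _)]
  congr 1
  have h2 : ∀ c : ℝ, |c - W h ω - (c - W g ω)| = |W g ω - W h ω| := fun c => by
    congr 1
    ring
  rw [h2, h2]
  ring

omit [Group G] in
/-- Two windows of width `b - a` meet only where the values of `W` differ by less than `b - a`. -/
theorem shiftedLaw_inter_window_le [SFinite P] {W : G → X → ℝ} (hW : ∀ g, Measurable (W g))
    (g h : G) (a b : ℝ) :
    shiftedLaw P W (window g a b ∩ window h a b) ≤
      ENNReal.ofReal (b - a) * P {ω | |W g ω - W h ω| < b - a} := by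
  rw [shiftedLaw_apply hW ((measurableSet_window g a b).inter (measurableSet_window h a b))]
  have hS : MeasurableSet {ω | |W g ω - W h ω| < b - a} :=
    measurableSet_lt ((hW g).sub (hW h)).abs measurable_const
  rw [← setLIntegral_const, ← lintegral_indicator hS]
  refine lintegral_mono fun ω => ?_
  by_cases hω : ω ∈ {ω | |W g ω - W h ω| < b - a}
  · rw [Set.indicator_of_mem hω]
    have h1 : {t : ℝ | shiftedPath W (ω, t) ∈ window g a b ∩ window h a b} ⊆
        Set.Ioo (a - W g ω) (b - W g ω) := by
      rintro t ⟨⟨h1, h2⟩, -⟩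
      simp only [shiftedPath] at h1 h2
      constructor <;> linarith
    refine (measure_mono h1).trans_eq ?_
    rw [Real.volume_Ioo]
    congr 1
    ring
  · rw [Set.indicator_of_notMem hω]
    have h1 : {t : ℝ | shiftedPath W (ω, t) ∈ window g a b ∩ window h a b} = ∅ := by
      refine Set.eq_empty_iff_forall_notMem.2 ?_
      rintro t ⟨⟨h1, h2⟩, ⟨h3, h4⟩⟩
      simp only [shiftedPath] at h1 h2 h3 h4
      refine hω ?_
      rw [Set.mem_ofPred_eq, abs_lt]
      constructor <;> linarith
    rw [h1, measure_empty]

end PathSpace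

section RandomField

variable {G : Type u} [Group G]

/-- For a map `β` of `G` into a Hilbert space with `G`-equivariant increments, there is an invariant
measure on path space for which windows of the same size at `g` and `h` almost coincide if `β g` is
close to `β h`, and are almost disjoint if `β g` is far from `β h`. It is the shifted law of the
Gaussian field with increments governed by `β`. -/
theorem exists_invariant_measure_pathSpace {H : Type*} [NormedAddCommGroup H]
    [InnerProductSpace ℝ H] [CompleteSpace H] (β : G → H)
    (hβ : ∀ k x y : G, inner ℝ (β (k * x) - β k) (β (k * y) - β k) =
      inner ℝ (β x - β 1) (β y - β 1)) :
    ∃ μ : Measure (PathSpace G), SMulInvariantMeasure G (PathSpace G) μ ∧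
      (∀ g a b, μ (window g a b) = ENNReal.ofReal (b - a)) ∧
      (∀ g h a b, μ (symmDiff (window g a b) (window h a b)) ≤
        ENNReal.ofReal (2 * ‖β g - β h‖)) ∧
      ∀ g h a b, β g ≠ β h → a ≤ b → μ (window g a b ∩ window h a b) ≤
        ENNReal.ofReal (2 * (b - a) ^ 2 / ‖β g - β h‖) := by
  obtain ⟨w, P, hP, Φ, hΦ⟩ := exists_isIsonormal H
  let W : G → (w → ℝ) → ℝ := fun g => Φ (β g)
  have hW : ∀ g, Measurable (W g) := fun g => measurable_isonormal Φ _
  have hsub : ∀ v v' : H, Φ (v - v') =ᵐ[P] fun ω => Φ v ω - Φ v' ω := fun v v' => by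
    rw [map_sub]
    exact Lp.coeFn_sub _ _
  refine ⟨shiftedLaw P W, smulInvariantMeasure_shiftedLaw hW fun k => ?_, shiftedLaw_window hW,
    fun g h a b => ?_, fun g h a b hgh hab => ?_⟩
  · have h1 : ∀ k : G, P.map (fun ω g => W (k * g) ω - W k ω) =
        P.map (fun ω g => Φ (β (k * g) - β k) ω) := fun k =>
      ProbabilityTheory.map_eq_of_forall_ae_eq (X := fun g ω => W (k * g) ω - W k ω)
        (Y := fun g ω => Φ (β (k * g) - β k) ω)
        (measurable_pi_lambda _ fun g => (hW _).sub (hW _)).aemeasurable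
        (measurable_pi_lambda _ fun g => measurable_isonormal Φ _).aemeasurable
        fun g => (hsub _ _).symm
    have h2 := h1 1
    simp only [one_mul] at h2
    rw [h1, h2]
    exact hΦ.map_eq_of_inner_eq _ _ fun x y => hβ k x y
  · refine (shiftedLaw_symmDiff_window_le hW g h a b).trans ?_
    have hint : Integrable (fun ω => 2 * |Φ (β g - β h) ω|) P :=
      ((Lp.memLp _).integrable (by norm_num)).abs.const_mul 2
    have h1 : ∫⁻ ω, ENNReal.ofReal (2 * |W g ω - W h ω|) ∂P =
        ∫⁻ ω, ENNReal.ofReal (2 * |Φ (β g - β h) ω|) ∂P := by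
      refine lintegral_congr_ae ?_
      filter_upwards [hsub (β g) (β h)] with ω hω
      rw [hω]
    rw [h1, ← ofReal_integral_eq_lintegral_ofReal hint
      (Eventually.of_forall fun ω => by positivity), integral_const_mul]
    refine ENNReal.ofReal_le_ofReal ?_
    gcongr
    refine (integral_abs_le_norm_L2 _).trans_eq ?_
    rw [LinearIsometry.norm_map]
  · refine (shiftedLaw_inter_window_le hW g h a b).trans ?_
    have h1 : P {ω | |W g ω - W h ω| < b - a} = P {ω | |Φ (β g - β h) ω| < b - a} := by
      refine measure_congr ?_
      filter_upwards [hsub (β g) (β h)] with ω hω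
      apply propext
      change |W g ω - W h ω| < b - a ↔ |Φ (β g - β h) ω| < b - a
      rw [hω]
    rw [h1]
    calc ENNReal.ofReal (b - a) * P {ω | |Φ (β g - β h) ω| < b - a}
        ≤ ENNReal.ofReal (b - a) * ENNReal.ofReal (2 * (b - a) / ‖β g - β h‖) := by
          gcongr
          exact hΦ.measure_abs_lt_le (sub_ne_zero.2 hgh) _
      _ = ENNReal.ofReal (2 * (b - a) ^ 2 / ‖β g - β h‖) := by
          rw [← ENNReal.ofReal_mul (by linarith)]
          congr 1
          ring

end RandomField

/-! ### Conditionally negative definite functions -/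

section ConditionallyNegative

/-- A real function `ψ` on a group is conditionally negative definite if it is symmetric, vanishes
at `1` and `∑ᵢⱼ wᵢ wⱼ ψ (gᵢ⁻¹ gⱼ) ≤ 0` for all finite families `gᵢ` and all real weights `wᵢ` of
total mass `0`. -/
structure IsConditionallyNegativeDefinite {G : Type u} [Group G] (ψ : G → ℝ) : Prop where
  map_one : ψ 1 = 0
  map_inv : ∀ g, ψ g⁻¹ = ψ g
  sum_nonpos : ∀ {ι : Type u} [Fintype ι] (p : ι → G) (w : ι → ℝ), ∑ i, w i = 0 →
    ∑ i, ∑ j, w i * w j * ψ ((p i)⁻¹ * p j) ≤ 0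

variable {G : Type u} [Group G]

/-- A positive semidefinite real kernel is the Gram matrix of a map into a Hilbert space. -/
theorem exists_inner_eq_of_posSemidef {X : Type u} (c : X → X → ℝ) (hc : ∀ x y, c x y = c y x)
    (hpos : ∀ (s : Finset X) (w : X → ℝ), 0 ≤ ∑ x ∈ s, ∑ y ∈ s, w x * w y * c x y) :
    ∃ (H : Type u) (_ : NormedAddCommGroup H) (_ : InnerProductSpace ℝ H) (_ : CompleteSpace H)
      (β : X → H), ∀ x y, inner ℝ (β x) (β y) = c x y := by
  let K : Matrix X X (ℝ →L[ℝ] ℝ) := Matrix.of fun x y => c x y • 1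
  have hK : K.PosSemidef := by
    have htfae := (RKHS.posSemidef_tfae (𝕜 := ℝ) (K := K)).out 0 2 rfl rfl
    refine htfae.2 ⟨?_, fun f => ?_⟩
    · ext x y
      simp [K, Matrix.conjTranspose_apply, hc x y]
    · refine (hpos f.support f).trans_eq ?_
      simp only [Finsupp.sum, RCLike.re_to_real]
      refine Finset.sum_congr rfl fun x _ => Finset.sum_congr rfl fun y _ => ?_
      simp only [K, Matrix.of_apply, FunLike.coe_smul, one_apply_eq_self,
        Pi.smul_apply, smul_eq_mul, RCLike.inner_apply, conj_trivial]
      rw [hc y x]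
      ring
  have : Fact K.PosSemidef := ⟨hK⟩
  refine ⟨RKHS.OfKernel K, inferInstance, inferInstance, inferInstance,
    fun x => RKHS.kerFun (RKHS.OfKernel K) x 1, fun x y => ?_⟩
  rw [RKHS.kerFun_inner, RKHS.kerFun_apply, RKHS.OfKernel.kernel_ofKernel]
  simp [K]

/-- Schoenberg's embedding: a conditionally negative definite function is the squared distance
function of a map into a Hilbert space with equivariant increments. -/
theorem IsConditionallyNegativeDefinite.exists_embedding {ψ : G → ℝ}
    (hψ : IsConditionallyNegativeDefinite ψ) :
    ∃ (H : Type u) (_ : NormedAddCommGroup H) (_ : InnerProductSpace ℝ H) (_ : CompleteSpace H)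
      (β : G → H), (∀ x y, ‖β x - β y‖ ^ 2 = ψ (x⁻¹ * y)) ∧
      ∀ k x y, inner ℝ (β (k * x) - β k) (β (k * y) - β k) =
        inner ℝ (β x - β 1) (β y - β 1) := by
  have hsymm : ∀ x y, ψ (x⁻¹ * y) = ψ (y⁻¹ * x) := fun x y => by
    rw [← hψ.map_inv, mul_inv_rev, inv_inv]
  obtain ⟨H, i1, i2, i3, β, hβ⟩ := exists_inner_eq_of_posSemidef
    (fun x y => (ψ x + ψ y - ψ (x⁻¹ * y)) / 2) (fun x y => by rw [hsymm x y]; ring)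
    (fun s w => by
      -- complete the weights to total mass `0` by an extra weight at the identity
      have h := hψ.sum_nonpos (ι := Option s) (fun i => i.elim 1 fun x => x)
        (fun i => i.elim (-∑ x : s, w x) fun x => w x) (by simp [Fintype.sum_option])
      simp only [Fintype.sum_option, Option.elim, inv_one, one_mul, hψ.map_one, mul_one,
        hψ.map_inv, mul_zero, zero_add, Finset.sum_add_distrib] at h
      simp_rw [← Finset.sum_coe_sort s]
      have e1 : ∑ x : s, ∑ y : s, w x * w y * ((ψ x + ψ y - ψ ((x : G)⁻¹ * y)) / 2) =
          ((∑ x : s, w x) * ∑ x : s, w x * ψ x) -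
            (∑ x : s, ∑ y : s, w x * w y * ψ ((x : G)⁻¹ * y)) / 2 := by
        have e2 : (∑ x : s, w x) * ∑ x : s, w x * ψ x =
            (∑ x : s, ∑ y : s, w x * w y * ψ x + ∑ x : s, ∑ y : s, w x * w y * ψ y) / 2 := by
          rw [Finset.sum_mul_sum, Finset.sum_comm (f := fun x y : s => w x * w y * ψ x),
            ← Finset.sum_add_distrib, Finset.sum_div]
          refine Finset.sum_congr rfl fun x _ => ?_
          rw [← Finset.sum_add_distrib, Finset.sum_div]
          refine Finset.sum_congr rfl fun y _ => ?_
          ring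
        rw [e2, ← sub_div, ← Finset.sum_add_distrib, ← Finset.sum_sub_distrib, Finset.sum_div]
        refine Finset.sum_congr rfl fun x _ => ?_
        rw [← Finset.sum_add_distrib, ← Finset.sum_sub_distrib, Finset.sum_div]
        refine Finset.sum_congr rfl fun y _ => ?_
        ring
      have e3 : ∀ S : ℝ, ∑ y : s, -S * w y * ψ y = -(S * ∑ x : s, w x * ψ x) := fun S => by
        rw [Finset.mul_sum, ← Finset.sum_neg_distrib]
        exact Finset.sum_congr rfl fun y _ => by ring
      have e4 : ∀ S : ℝ, ∑ x : s, w x * -S * ψ x = -(S * ∑ x : s, w x * ψ x) := fun S => by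
        rw [Finset.mul_sum, ← Finset.sum_neg_distrib]
        exact Finset.sum_congr rfl fun y _ => by ring
      rw [e1]
      rw [e3, e4] at h
      linarith)
  refine ⟨H, i1, i2, i3, β, fun x y => ?_, fun k x y => ?_⟩
  · rw [norm_sub_sq_real, ← real_inner_self_eq_norm_sq, ← real_inner_self_eq_norm_sq, hβ, hβ, hβ]
    simp only [inv_mul_cancel, hψ.map_one]
    ring
  · have h1 : (k * x)⁻¹ * (k * y) = x⁻¹ * y := by group
    have h2 : (k * x)⁻¹ * k = x⁻¹ := by group
    simp only [inner_sub_left, inner_sub_right, hβ, h1, h2, inv_mul_cancel_left, inv_mul_cancel,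
      hψ.map_one, hψ.map_inv, inv_one, one_mul, mul_one]
    ring

namespace IsPositiveDefinite

variable {φ : G → ℂ}

theorem sum_re_nonneg (hφ : IsPositiveDefinite φ) {ι : Type*} [Fintype ι] (p : ι → G)
    (w : ι → ℝ) : 0 ≤ ∑ i, ∑ j, w i * w j * (φ ((p i)⁻¹ * p j)).re := by
  let e := (Fintype.equivFin ι).symm
  have h := (hφ _ (p ∘ e)).dotProduct_mulVec_nonneg fun i => (w (e i) : ℂ)
  have h2 := (Complex.le_def.1 h).1
  rw [← e.sum_comp]
  simp_rw [← e.sum_comp (fun j => w _ * w j * _)]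
  refine h2.trans_eq ?_
  simp only [dotProduct, Matrix.mulVec, Finset.mul_sum, Complex.re_sum]
  refine Finset.sum_congr rfl fun i _ => Finset.sum_congr rfl fun j _ => ?_
  simp [mul_assoc, mul_comm]

theorem re_map_inv (hφ : IsPositiveDefinite φ) (g : G) : (φ g⁻¹).re = (φ g).re := by
  have h := (hφ 2 ![1, g]).isHermitian.apply 0 1
  simp only [Matrix.of_apply, Matrix.cons_val_zero, Matrix.cons_val_one, inv_one, one_mul,
    mul_one] at h
  rw [← h]
  simp

theorem re_le_one (hφ : IsPositiveDefinite φ) (h1 : φ 1 = 1) (g : G) : (φ g).re ≤ 1 := by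
  have h := hφ.sum_re_nonneg (ι := Fin 2) ![1, g] ![1, -1]
  simp only [Fin.sum_univ_two, Matrix.cons_val_zero, Matrix.cons_val_one, inv_one, one_mul,
    mul_one, inv_mul_cancel, h1, hφ.re_map_inv, Complex.one_re] at h
  linarith

end IsPositiveDefinite

/-- A pointwise convergent series of functions `2 (1 - Re φₖ)`, with `φₖ` normalized and positive
definite, is conditionally negative definite. -/
theorem isConditionallyNegativeDefinite_of_hasSum {φ : ℕ → G → ℂ}
    (hφ : ∀ k, IsPositiveDefinite (φ k)) (hφ1 : ∀ k, φ k 1 = 1) {ψ : G → ℝ}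
    (hψ : ∀ g, HasSum (fun k => 2 * (1 - (φ k g).re)) (ψ g)) :
    IsConditionallyNegativeDefinite ψ where
  map_one := (hψ 1).unique (by simp [hφ1])
  map_inv g := (hψ g⁻¹).unique (by simpa only [(hφ _).re_map_inv] using hψ g)
  sum_nonpos p w hw := by
    have h : HasSum (fun k => ∑ i, ∑ j, w i * w j * (2 * (1 - (φ k ((p i)⁻¹ * p j)).re)))
        (∑ i, ∑ j, w i * w j * ψ ((p i)⁻¹ * p j)) :=
      hasSum_sum fun i _ => hasSum_sum fun j _ => (hψ _).mul_left _
    refine h.nonpos fun k => ?_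
    have h1 := (hφ k).sum_re_nonneg p w
    have h2 : ∑ i, ∑ j, w i * w j * (2 * (1 - (φ k ((p i)⁻¹ * p j)).re)) =
        2 * ((∑ i, w i) * ∑ j, w j) - 2 * ∑ i, ∑ j, w i * w j * (φ k ((p i)⁻¹ * p j)).re := by
      simp_rw [Finset.sum_mul_sum, Finset.mul_sum, ← Finset.sum_sub_distrib]
      exact Finset.sum_congr rfl fun i _ => Finset.sum_congr rfl fun j _ => by ring
    rw [h2, hw]
    linarith

variable [TopologicalSpace G] [IsTopologicalGroup G] [LocallyCompactSpace G]
  [SecondCountableTopology G]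

/-- A group with the Haagerup property carries a proper continuous conditionally negative definite
function. -/
theorem HasHaagerupProperty.exists_isConditionallyNegativeDefinite (h : HasHaagerupProperty G) :
    ∃ ψ : G → ℝ, IsConditionallyNegativeDefinite ψ ∧ Continuous ψ ∧
      Tendsto ψ (cocompact G) atTop := by
  obtain ⟨φ, hφ, hφ1, hφK⟩ := h
  let K := CompactExhaustion.choice G
  have hn : ∀ k, ∃ n, ∀ g ∈ K k, ‖φ n g - 1‖ < (1 / 2) ^ k := fun k => by
    have := Metric.tendstoUniformlyOn_iff.1 (hφK (K k) (K.isCompact k)) ((1 / 2) ^ k)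
      (by positivity)
    obtain ⟨n, hn⟩ := this.exists
    refine ⟨n, fun g hg => ?_⟩
    rw [← dist_eq_norm, dist_comm]
    exact hn g hg
  choose n hn using hn
  let f : ℕ → G → ℝ := fun k g => 2 * (1 - (φ (n k) g).re)
  have hf0 : ∀ k g, 0 ≤ f k g := fun k g => by
    have := (hφ (n k)).re_le_one (hφ1 _) g
    simp only [f]
    linarith
  have hre : ∀ z : ℂ, 1 - z.re ≤ ‖z - 1‖ := fun z => by
    have := (neg_le_abs _).trans (Complex.abs_re_le_norm (z - 1))
    simpa using this
  -- on `K m` the series is dominated by the geometric series, up to finitely many terms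
  let b : ℕ → ℕ → ℝ := fun m k => if k < m then 2 * (‖φ (n k)‖ + 1) else 2 * (1 / 2) ^ k
  have hb : ∀ m, Summable (b m) := fun m => by
    refine (summable_geometric_two.mul_left 2).congr_cofinite ?_
    rw [Nat.cofinite_eq_atTop]
    filter_upwards [eventually_ge_atTop m] with k hk
    simp [b, hk.not_gt]
  have hfb : ∀ m k g, g ∈ K m → ‖f k g‖ ≤ b m k := fun m k g hg => by
    rw [Real.norm_of_nonneg (hf0 k g)]
    have h1 := hre (φ (n k) g)
    simp only [f, b]
    split_ifs with hk
    · have h2 := norm_sub_le (φ (n k) g) 1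
      have h3 := (φ (n k)).toBCF.norm_coe_le_norm g
      rw [ZeroAtInftyContinuousMap.norm_toBCF_eq_norm] at h3
      rw [norm_one] at h2
      have h4 : ‖φ (n k) g‖ ≤ ‖φ (n k)‖ := h3
      linarith
    · have h2 := hn k g (K.subset (not_lt.1 hk) hg)
      linarith
  have hsum : ∀ g, Summable fun k => f k g := fun g => by
    obtain ⟨m, hm⟩ := K.exists_mem g
    exact Summable.of_norm_bounded (hb m) fun k => hfb m k g hm
  refine ⟨fun g => ∑' k, f k g, isConditionallyNegativeDefinite_of_hasSum
    (φ := fun k g => φ (n k) g) (fun k => hφ _) (fun k => hφ1 _) (fun g => (hsum g).hasSum),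
    ?_, ?_⟩
  · refine continuous_iff_continuousAt.2 fun g => ?_
    obtain ⟨m, hm⟩ := K.exists_mem_nhds g
    refine (continuousOn_tsum (fun k => ?_) (hb m) fun k x hx => hfb m k x hx).continuousAt hm
    have : Continuous (φ (n k)) := map_continuous (φ (n k))
    fun_prop
  · refine tendsto_atTop.2 fun M => ?_
    obtain ⟨N, hN⟩ := exists_nat_gt M
    have h1 : Tendsto (fun g => ∑ k ∈ Finset.range N, f k g) (cocompact G)
        (𝓝 (∑ k ∈ Finset.range N, 2)) := by
      refine tendsto_finsetSum _ fun k _ => ?_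
      have h2 := (Complex.continuous_re.tendsto _).comp (zero_at_infty (φ (n k)))
      simpa using (h2.const_sub 1).const_mul 2
    have h3 : M < ∑ k ∈ Finset.range N, (2 : ℝ) := by
      rw [Finset.sum_const, Finset.card_range, nsmul_eq_mul]
      have : (0 : ℝ) ≤ N := N.cast_nonneg
      linarith
    filter_upwards [h1.eventually_const_lt h3] with g hg
    exact hg.le.trans ((hsum g).sum_le_tsum _ fun k _ => hf0 k g)

end ConditionallyNegative

/-! ### Følner sequences of sets -/

section Folner

/-- A pointwise bounded sequence of linear functionals has a linear limit along an ultrafilter. -/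
theorem exists_linearMap_tendsto_ultrafilter {ι E : Type*} [AddCommGroup E] [Module ℂ E]
    (U : Ultrafilter ι) (a : ι → E →ₗ[ℂ] ℂ) (ha : ∀ F, ∃ C, ∀ i, ‖a i F‖ ≤ C) :
    ∃ m : E →ₗ[ℂ] ℂ, ∀ F, Tendsto (fun i => a i F) U (𝓝 (m F)) := by
  have h : ∀ F, ∃ z, Tendsto (fun i => a i F) U (𝓝 z) := fun F => by
    obtain ⟨C, hC⟩ := ha F
    obtain ⟨z, -, hz⟩ := (isCompact_closedBall (0 : ℂ) C).ultrafilter_le_nhds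
      (U.map fun i => a i F) (tendsto_principal.2 (Eventually.of_forall fun i => by
        simpa using hC i))
    exact ⟨z, hz⟩
  choose m hm using h
  refine ⟨{ toFun := m, map_add' := fun F F' => ?_, map_smul' := fun c F => ?_ }, hm⟩
  · refine tendsto_nhds_unique (hm (F + F')) ?_
    simpa only [map_add] using (hm F).add (hm F')
  · refine tendsto_nhds_unique (hm (c • F)) ?_
    simpa only [map_smul, RingHom.id_apply] using (hm F).const_smul c

/-- The integrals of a bounded function over two sets which almost agree are close. -/
theorem norm_setIntegral_sub_setIntegral_le {Ω : Type*} [MeasurableSpace Ω] {μ : Measure Ω}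
    {f : Ω → ℂ} {s t : Set Ω} {C : ℝ} (hs : MeasurableSet s) (ht : MeasurableSet t)
    (hμs : μ s ≠ ∞) (hμt : μ t ≠ ∞) (hfs : IntegrableOn f s μ) (hft : IntegrableOn f t μ)
    (hf : ∀ᵐ x ∂μ, ‖f x‖ ≤ C) :
    ‖∫ x in s, f x ∂μ - ∫ x in t, f x ∂μ‖ ≤ C * μ.real (symmDiff s t) := by
  have h1 := norm_setIntegral_le_of_norm_le_const_ae' (μ := μ) (s := s \ t) (C := C) (f := f)
    ((measure_mono Set.sdiff_subset).trans_lt hμs.lt_top) (hf.mono fun x hx _ => hx)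
  have h2 := norm_setIntegral_le_of_norm_le_const_ae' (μ := μ) (s := t \ s) (C := C) (f := f)
    ((measure_mono Set.sdiff_subset).trans_lt hμt.lt_top) (hf.mono fun x hx _ => hx)
  rw [← integral_inter_add_sdiff ht hfs, ← integral_inter_add_sdiff hs hft, Set.inter_comm t s,
    add_sub_add_left_eq_sub, Set.symmDiff_def, measureReal_union
      (Set.disjoint_left.2 fun x hx hx' => hx.2 hx'.1) (MeasurableSet.diff ht hs)
      (measure_ne_top_of_subset Set.sdiff_subset hμs)
      (measure_ne_top_of_subset Set.sdiff_subset hμt), mul_add]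
  exact (norm_sub_le _ _).trans (add_le_add h1 h2)

variable {G : Type u} [Group G] {Ω : Type u} [MeasurableSpace Ω] [MulAction G Ω]
  [MeasurableConstSMul G Ω] {μ : Measure Ω} [SMulInvariantMeasure G Ω μ]

theorem setIntegral_mk_inv_smul (F : Lp ℂ ∞ μ) (g : G) (W : Set Ω) :
    ∫ x in W, (DomMulAct.mk g⁻¹ • F) x ∂μ = ∫ x in g⁻¹ • W, F x ∂μ := by
  rw [integral_congr_ae (ae_restrict_of_ae (DomMulAct.smul_Lp_ae_eq (DomMulAct.mk g⁻¹) F))]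
  have := (measurePreserving_smul g⁻¹ μ).setIntegral_preimage_emb
    (measurableEmbedding_const_smul g⁻¹) F (g⁻¹ • W)
  rw [← this, Set.preimage_smul, inv_inv, smul_inv_smul]
  rfl

/-- A Følner sequence of sets yields an invariant mean, as an ultrafilter limit of averages. -/
theorem hasInvariantMean_of_folner {W : ℕ → Set Ω} (hW : ∀ n, MeasurableSet (W n))
    (hW0 : ∀ n, μ (W n) ≠ 0) (hWfin : ∀ n, μ (W n) ≠ ∞)
    (h : ∀ g : G, Tendsto (fun n => μ.real (symmDiff (g • W n) (W n)) / μ.real (W n))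
      atTop (𝓝 0)) : HasInvariantMean G μ := by
  have hpos : ∀ n, 0 < μ.real (W n) := fun n => ENNReal.toReal_pos (hW0 n) (hWfin n)
  have hint : ∀ (F : Lp ℂ ∞ μ) {A : Set Ω}, μ A ≠ ∞ → IntegrableOn F A μ := fun F A hA =>
    integrableOn_linfty F hA.lt_top
  have hbd : ∀ F : Lp ℂ ∞ μ, ∀ᵐ x ∂μ, ‖F x‖ ≤ ‖F‖ := fun F => by
    filter_upwards [enorm_ae_le_eLpNormEssSup F μ] with x hx
    rwa [← eLpNorm_exponent_top, ← Lp.enorm_def, enorm_le_iff_norm_le] at hx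
  let a : ℕ → Lp ℂ ∞ μ →ₗ[ℂ] ℂ := fun n =>
    { toFun := fun F => ((μ.real (W n))⁻¹ : ℂ) * ∫ x in W n, F x ∂μ
      map_add' := fun F F' => by
        rw [← mul_add, ← integral_add (hint F (hWfin n)) (hint F' (hWfin n))]
        congr 1
        exact integral_congr_ae (ae_restrict_of_ae (Lp.coeFn_add F F'))
      map_smul' := fun c F => by
        rw [RingHom.id_apply, smul_eq_mul, mul_left_comm, ← integral_const_mul c]
        congr 1
        exact integral_congr_ae (ae_restrict_of_ae (Lp.coeFn_smul c F)) }
  have ha : ∀ n F, a n F = ((μ.real (W n))⁻¹ : ℂ) * ∫ x in W n, F x ∂μ := fun n F => rfl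
  have hnorm : ∀ n, ‖((μ.real (W n))⁻¹ : ℂ)‖ = (μ.real (W n))⁻¹ := fun n => by
    rw [norm_inv, Complex.norm_real, Real.norm_of_nonneg (hpos n).le]
  obtain ⟨m, hm⟩ := exists_linearMap_tendsto_ultrafilter (hyperfilter ℕ) a fun F => by
    refine ⟨‖F‖, fun n => ?_⟩
    rw [ha, norm_mul, hnorm, inv_mul_le_iff₀ (hpos n), mul_comm]
    exact norm_setIntegral_le_of_norm_le_const_ae' (hWfin n).lt_top ((hbd F).mono fun x hx _ => hx)
  have hle : (hyperfilter ℕ : Filter ℕ) ≤ atTop := Nat.hyperfilter_le_atTop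
  refine ⟨m, fun F hF => ?_, ?_, fun g F => ?_⟩
  · refine ge_of_tendsto (hm F) (Eventually.of_forall fun n => ?_)
    rw [ha]
    refine mul_nonneg ?_ (integral_nonneg_of_ae (ae_restrict_of_ae hF))
    rw [← Complex.ofReal_inv]
    exact_mod_cast inv_nonneg.2 (hpos n).le
  · refine tendsto_nhds_unique (hm _) (tendsto_const_nhds.congr fun n => ?_)
    rw [ha, integral_congr_ae (ae_restrict_of_ae
      (memLp_top_const (1 : ℂ)).coeFn_toLp), setIntegral_const]
    have : (μ.real (W n) : ℂ) ≠ 0 := Complex.ofReal_ne_zero.2 (hpos n).ne'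
    simp [this]
  · have h1 := (hm (DomMulAct.mk g⁻¹ • F)).sub (hm F)
    have h2 : Tendsto (fun n => a n (DomMulAct.mk g⁻¹ • F) - a n F) atTop (𝓝 0) := by
      refine squeeze_zero_norm (fun n => ?_) (by simpa using (h g⁻¹).const_mul ‖F‖)
      have hg : μ (g⁻¹ • W n) ≠ ∞ := by rw [measure_smul]; exact hWfin n
      rw [ha, ha, setIntegral_mk_inv_smul, ← mul_sub, norm_mul, hnorm, mul_div_assoc', div_eq_inv_mul]
      exact mul_le_mul_of_nonneg_left (norm_setIntegral_sub_setIntegral_le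
        ((hW n).const_smul _) (hW n) hg (hWfin n) (hint F hg) (hint F (hWfin n)) (hbd F))
        (inv_nonneg.2 (hpos n).le)
    exact sub_eq_zero.1 (tendsto_nhds_unique h1 (h2.mono_left hle))

/-- The normalized indicator functions of a Følner sequence of sets are almost invariant. -/
theorem hasAlmostInvariantUnitVectors_of_folner [TopologicalSpace G] {W : ℕ → Set Ω}
    (hW : ∀ n, MeasurableSet (W n)) (hW0 : ∀ n, μ (W n) ≠ 0) (hWfin : ∀ n, μ (W n) ≠ ∞)
    (h : ∀ K : Set G, IsCompact K →
      TendstoUniformlyOn (fun (n : ℕ) (g : G) => μ.real (symmDiff (g • W n) (W n)) / μ.real (W n))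
        (fun _ => 0) atTop K) : HasAlmostInvariantUnitVectors G μ := by
  have hpos : ∀ n, 0 < μ.real (W n) := fun n => ENNReal.toReal_pos (hW0 n) (hWfin n)
  let c : ℕ → ℝ := fun n => (√(μ.real (W n)))⁻¹
  have hc : ∀ n, 0 ≤ c n := fun n => inv_nonneg.2 (Real.sqrt_nonneg _)
  have hc2 : ∀ n, c n * c n = (μ.real (W n))⁻¹ := fun n => by
    simp only [c]
    rw [← mul_inv, Real.mul_self_sqrt (hpos n).le]
  refine ⟨fun n => indicatorConstLp 2 (hW n) (hWfin n) (c n : ℂ), fun n => ?_, fun n => ?_,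
    fun K hK => ?_⟩
  · rw [norm_indicatorConstLp two_ne_zero ENNReal.ofNat_ne_top, ENNReal.toReal_ofNat,
      ← Real.sqrt_eq_rpow, Complex.norm_real, Real.norm_of_nonneg (hc n)]
    exact inv_mul_cancel₀ (Real.sqrt_pos.2 (hpos n)).ne'
  · filter_upwards [indicatorConstLp_coeFn (p := 2) (hs := hW n) (hμs := hWfin n)
      (c := (c n : ℂ))] with x hx
    rw [hx]
    exact Set.indicator_nonneg (fun _ _ => by exact_mod_cast hc n) x
  · refine Metric.tendstoUniformlyOn_iff.2 fun ε hε => ?_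
    filter_upwards [Metric.tendstoUniformlyOn_iff.1 (h K hK) ε hε] with n hn g hg
    refine lt_of_le_of_lt ?_ (hn g hg)
    have hgW : μ (g • W n) ≠ ∞ := by rw [measure_smul]; exact hWfin n
    have e1 : inner ℂ (permRep G μ g (indicatorConstLp 2 (hW n) (hWfin n) (c n : ℂ)))
        (indicatorConstLp 2 (hW n) (hWfin n) (c n : ℂ)) =
        ((μ.real (g • W n ∩ W n) / μ.real (W n) : ℝ) : ℂ) := by
      change inner ℂ (DomMulAct.mk g⁻¹ • indicatorConstLp 2 (hW n) (hWfin n) (c n : ℂ))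
        (indicatorConstLp 2 (hW n) (hWfin n) (c n : ℂ)) = _
      rw [mk_inv_smul_indicatorConstLp, L2.inner_indicatorConstLp_indicatorConstLp _ _ _ (hWfin n),
        div_eq_mul_inv, ← hc2]
      simp [sq, abs_of_nonneg (hc n)]
    have e2 : μ.real (g • W n ∩ W n) = μ.real (W n) - μ.real (W n \ g • W n) := by
      rw [eq_sub_iff_add_eq, Set.inter_comm]
      exact measureReal_inter_add_sdiff ((hW n).const_smul g) (hWfin n)
    rw [e1, dist_comm, ← Complex.ofReal_one, Complex.dist_eq, ← Complex.ofReal_sub,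
      Complex.norm_real, dist_zero_left, Real.norm_eq_abs, Real.norm_eq_abs, e2, sub_div,
      div_self (hpos n).ne', sub_sub_cancel_left, abs_neg, abs_of_nonneg (by positivity),
      abs_of_nonneg (by positivity)]
    refine div_le_div_of_nonneg_right (measureReal_mono Set.subset_union_right ?_) (hpos n).le
    exact measure_ne_top_of_subset Set.symmDiff_subset_union
      (measure_union_ne_top hgW (hWfin n))

end Folner

/-! ### The shifted Gaussian system -/

section WindowEstimates

variable {G : Type u} [Group G]

/-- The estimates for the measures of windows in terms of a function `ψ` on the group that hold
for the law of a Gaussian process with variogram `ψ (g⁻¹ h)` shifted by Lebesgue measure. -/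
structure HasWindowEstimates (μ : Measure (PathSpace G)) (ψ : G → ℝ) : Prop where
  measure_window : ∀ g a b, μ (window g a b) = ENNReal.ofReal (b - a)
  measure_symmDiff_le : ∀ g h a b,
    μ (symmDiff (window g a b) (window h a b)) ≤ ENNReal.ofReal (2 * √(ψ (g⁻¹ * h)))
  measure_inter_le : ∀ g h a b, 0 < ψ (g⁻¹ * h) → a ≤ b →
    μ (window g a b ∩ window h a b) ≤ ENNReal.ofReal (2 * (b - a) ^ 2 / √(ψ (g⁻¹ * h)))

theorem IsConditionallyNegativeDefinite.exists_hasWindowEstimates {ψ : G → ℝ}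
    (hψ : IsConditionallyNegativeDefinite ψ) :
    ∃ μ : Measure (PathSpace G), SMulInvariantMeasure G (PathSpace G) μ ∧
      HasWindowEstimates μ ψ := by
  obtain ⟨H, _, _, _, β, hβψ, hβ⟩ := hψ.exists_embedding
  obtain ⟨μ, hinv, h1, h2, h3⟩ := exists_invariant_measure_pathSpace β hβ
  have hn : ∀ g h, √(ψ (g⁻¹ * h)) = ‖β g - β h‖ := fun g h => by
    rw [← hβψ, Real.sqrt_sq (norm_nonneg _)]
  refine ⟨μ, hinv, h1, fun g h a b => hn g h ▸ h2 g h a b, fun g h a b hpos hab => ?_⟩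
  rw [hn]
  refine h3 g h a b (fun he => ?_) hab
  rw [← hβψ, he, sub_self, norm_zero] at hpos
  simp at hpos

/-- The windows generate the σ-algebra of path space. -/
theorem measurableSpace_pathSpace_le (G : Type u) :
    (inferInstance : MeasurableSpace (PathSpace G)) ≤
      MeasurableSpace.generateFrom {s | ∃ (g : G) (a b : ℝ), s = window g a b} := by
  refine iSup_le fun g => ?_
  change (borel ℝ).comap _ ≤ _
  rw [Real.borel_eq_generateFrom_Ioo_rat, MeasurableSpace.comap_generateFrom]
  refine MeasurableSpace.generateFrom_mono ?_
  rintro _ ⟨t, ht, rfl⟩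
  simp only [Set.mem_iUnion, Set.mem_singleton_iff] at ht
  obtain ⟨a, b, -, rfl⟩ := ht
  exact ⟨g, a, b, rfl⟩

omit [Group G] in
theorem monotone_window_neg_nat (g : G) : Monotone fun k : ℕ => window g (-k : ℝ) k :=
  fun k l hkl y hy => by
    have : (k : ℝ) ≤ l := by exact_mod_cast hkl
    exact ⟨by linarith [hy.1], by linarith [hy.2]⟩

omit [Group G] in
theorem iUnion_window_neg_nat (g : G) : ⋃ k : ℕ, window g (-k : ℝ) k = Set.univ := by
  refine Set.eq_univ_of_forall fun y => ?_
  obtain ⟨k, hk⟩ := exists_nat_gt |y g|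
  exact Set.mem_iUnion.2 ⟨k, abs_lt.1 hk⟩

namespace HasWindowEstimates

variable {μ : Measure (PathSpace G)} {ψ : G → ℝ}

theorem measure_window_ne_top (hμ : HasWindowEstimates μ ψ) (g : G) (a b : ℝ) :
    μ (window g a b) ≠ ∞ := by
  rw [hμ.measure_window]
  exact ENNReal.ofReal_ne_top

theorem measure_window_ne_zero (hμ : HasWindowEstimates μ ψ) (n : ℕ) :
    μ (window (1 : G) 0 ((n : ℝ) + 1)) ≠ 0 := by
  rw [hμ.measure_window, sub_zero]
  exact (ENNReal.ofReal_pos.2 (by positivity)).ne'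

theorem sigmaFinite (hμ : HasWindowEstimates μ ψ) : SigmaFinite μ :=
  ⟨⟨{ set := fun k : ℕ => window (1 : G) (-k : ℝ) k
      set_mem := fun _ => trivial
      finite := fun _ => (hμ.measure_window_ne_top _ _ _).lt_top
      spanning := iUnion_window_neg_nat 1 }⟩⟩

/-- A family of sets that contains all windows and is closed under unions, differences and
approximation in measure contains all measurable sets of finite measure. -/
theorem mem_of_window_mem (hμ : HasWindowEstimates μ ψ) {C : Set (Set (PathSpace G))}
    (hC : ∀ g a b, window g a b ∈ C) (hunion : ∀ s ∈ C, ∀ t ∈ C, s ∪ t ∈ C)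
    (hdiff : ∀ s ∈ C, ∀ t ∈ C, s \ t ∈ C)
    (happrox : ∀ s, (∀ ε : ℝ≥0∞, ε ≠ 0 → ∃ t ∈ C, μ (symmDiff t s) ≤ ε) → s ∈ C)
    {A : Set (PathSpace G)} (hA : MeasurableSet A) (hμA : μ A ≠ ∞) : A ∈ C := by
  have hinter : ∀ s ∈ C, ∀ t ∈ C, s ∩ t ∈ C := fun s hs t ht => by
    rw [← Set.sdiff_sdiff_right_self]
    exact hdiff _ hs _ (hdiff _ hs _ ht)
  have hempty : ∅ ∈ C := by
    rw [← Set.sdiff_self (s := window (1 : G) 0 0)]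
    exact hdiff _ (hC _ _ _) _ (hC _ _ _)
  have hmono : ∀ s : ℕ → Set (PathSpace G), (∀ n, MeasurableSet (s n)) → Monotone s →
      (∀ n, s n ∈ C) → μ (⋃ n, s n) ≠ ∞ → ⋃ n, s n ∈ C := fun s hs hsm hsC hfin =>
    happrox _ fun ε hε => by
      have := (tendsto_measure_symmDiff_iUnion hs hsm hfin).eventually_le_const
        (pos_iff_ne_zero.2 hε)
      obtain ⟨n, hn⟩ := this.exists
      exact ⟨s n, hsC n, hn⟩
  -- it suffices to treat the subsets of a fixed window
  have key : ∀ (k : ℕ) (B : Set (PathSpace G)), MeasurableSet B →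
      B ∩ window 1 (-k : ℝ) k ∈ C := fun k B hB => by
    have hE : MeasurableSet (window (1 : G) (-k : ℝ) k) := measurableSet_window _ _ _
    have hfin : ∀ B : Set (PathSpace G), μ (B ∩ window 1 (-k : ℝ) k) ≠ ∞ := fun B =>
      measure_ne_top_of_subset Set.inter_subset_right (hμ.measure_window_ne_top _ _ _)
    have hle : MeasurableSpace.generateFrom {s | ∃ (g : G) (a b : ℝ), s = window g a b} ≤
        (inferInstance : MeasurableSpace (PathSpace G)) := by
      refine MeasurableSpace.generateFrom_le ?_
      rintro _ ⟨g, a, b, rfl⟩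
      exact measurableSet_window g a b
    induction B, measurableSpace_pathSpace_le G _ hB using MeasurableSpace.generateFrom_induction with
    | hC t ht _ =>
      obtain ⟨g, a, b, rfl⟩ := ht
      exact hinter _ (hC _ _ _) _ (hC _ _ _)
    | empty =>
      rwa [Set.empty_inter]
    | compl t ht ih =>
      have : tᶜ ∩ window (1 : G) (-k : ℝ) k =
          window 1 (-k : ℝ) k \ (t ∩ window 1 (-k : ℝ) k) := by
        rw [Set.inter_comm, ← Set.sdiff_eq, Set.inter_comm, Set.sdiff_self_inter]
      rw [this]
      exact hdiff _ (hC _ _ _) _ (ih (hle _ ht))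
    | iUnion s hs ih =>
      rw [← Set.iUnion_accumulate, Set.iUnion_inter]
      have hmeas : ∀ n, MeasurableSet (Set.accumulate s n) := fun n =>
        MeasurableSet.iUnion fun i => MeasurableSet.iUnion fun _ => hle _ (hs i)
      refine hmono _ (fun n => (hmeas n).inter hE)
        (fun m n hmn => Set.inter_subset_inter_left _ (Set.monotone_accumulate hmn)) (fun n => ?_) ?_
      · induction n with
        | zero =>
          rw [Set.accumulate_zero_nat]
          exact ih 0 (hle _ (hs 0))
        | succ n ihn =>
          rw [Set.accumulate_succ, Set.union_inter_distrib_right]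
          exact hunion _ ihn _ (ih _ (hle _ (hs _)))
      · rw [← Set.iUnion_inter]
        exact hfin _
  have hAk : A = ⋃ k : ℕ, A ∩ window 1 (-k : ℝ) k := by
    rw [← Set.inter_iUnion, iUnion_window_neg_nat, Set.inter_univ]
  rw [hAk]
  refine hmono _ (fun k => hA.inter (measurableSet_window _ _ _))
    (fun m n hmn => Set.inter_subset_inter_right _ (monotone_window_neg_nat 1 hmn))
    (fun k => key k A hA) ?_
  rwa [← hAk]

end HasWindowEstimates

end WindowEstimates

section SymmDiff

theorem tendsto_ofReal_sqrt {ι : Type*} {l : Filter ι} {f : ι → ℝ} (hf : Tendsto f l (𝓝 0)) :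
    Tendsto (fun i => ENNReal.ofReal (2 * √(f i))) l (𝓝 0) := by
  have := ENNReal.tendsto_ofReal ((Real.continuous_sqrt.tendsto 0).comp hf |>.const_mul 2)
  simpa using this

theorem measure_smul_symmDiff_smul {G Ω : Type*} [Group G] [MeasurableSpace Ω] [MulAction G Ω]
    [MeasurableConstSMul G Ω] {μ : Measure Ω} [SMulInvariantMeasure G Ω μ] (g : G) (s t : Set Ω) :
    μ (symmDiff (g • s) (g • t)) = μ (symmDiff s t) := by
  rw [← Set.smul_set_symmDiff, measure_smul]

theorem sdiff_symmDiff_sdiff_subset {X : Type*} (s t u v : Set X) :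
    symmDiff (s \ t) (u \ v) ⊆ symmDiff s u ∪ symmDiff t v := by
  intro x
  simp only [Set.mem_symmDiff, Set.mem_sdiff, Set.mem_union]
  tauto

theorem inter_subset_symmDiff_union_inter {X : Type*} (s t u : Set X) :
    s ∩ u ⊆ symmDiff s t ∪ t ∩ u := by
  intro x
  simp only [Set.mem_symmDiff, Set.mem_inter_iff, Set.mem_union]
  tauto

end SymmDiff

section ShiftedGaussian

variable {G : Type u} [Group G]

namespace HasWindowEstimates

variable {μ : Measure (PathSpace G)} {ψ : G → ℝ} [TopologicalSpace G]

/-- The countable algebra of sets generated by the windows at points of a dense sequence with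
rational end points is dense in measure. -/
theorem isSeparable [IsTopologicalGroup G] [SecondCountableTopology G]
    (hμ : HasWindowEstimates μ ψ) (hψ1 : ψ 1 = 0) (hψ : Continuous ψ) :
    MeasureTheory.IsSeparable μ := by
  obtain ⟨D, hDc, hD⟩ := TopologicalSpace.exists_countable_dense G
  let 𝒲 : Set (Set (PathSpace G)) :=
    (fun x : G × ℚ × ℚ => window x.1 (x.2.1 : ℝ) x.2.2) '' (D ×ˢ Set.univ)
  have h𝒲 : 𝒲.Countable := (hDc.prod Set.countable_univ).image _
  let 𝒜 := generateSetAlgebra 𝒲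
  have h𝒜 : IsSetAlgebra 𝒜 := isSetAlgebra_generateSetAlgebra
  have hmeas : ∀ s ∈ 𝒜, MeasurableSet s := by
    intro s hs
    induction hs with
    | base s hs =>
      obtain ⟨x, -, rfl⟩ := hs
      exact measurableSet_window _ _ _
    | empty => exact MeasurableSet.empty
    | compl s _ ih => exact ih.compl
    | union s t _ _ ihs iht => exact ihs.union iht
  refine ⟨𝒜, countable_generateSetAlgebra h𝒲, hmeas, fun A hA hμA ε hε => ?_⟩
  have hhalf : ∀ {ε : ℝ≥0∞}, ε ≠ 0 → ε / 2 ≠ 0 := fun hε => (ENNReal.half_pos hε).ne'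
  have key := hμ.mem_of_window_mem
    (C := {s | ∀ ε : ℝ≥0∞, ε ≠ 0 → ∃ t ∈ 𝒜, μ (symmDiff t s) ≤ ε}) (fun g a b ε hε => ?_)
    (fun s hs t ht ε hε => ?_) (fun s hs t ht ε hε => ?_) (fun s hs ε hε => ?_) hA hμA
  · obtain ⟨t, ht, htA⟩ := key (ENNReal.ofReal (ε / 2)) (by simpa using hε)
    refine ⟨t, ht, ?_⟩
    rw [symmDiff_comm]
    exact htA.trans_lt ((ENNReal.ofReal_lt_ofReal_iff hε).2 (half_lt_self hε))
  · -- shrink the interval to one with rational end points, and move the base point into `D`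
    have h1 : Tendsto (fun d => ENNReal.ofReal (2 * √(ψ (d⁻¹ * g)))) (𝓝 g) (𝓝 0) := by
      refine tendsto_ofReal_sqrt ?_
      have : Continuous fun d => ψ (d⁻¹ * g) := by fun_prop
      simpa [hψ1] using this.tendsto g
    obtain ⟨d, hdD, hd⟩ := hD.inter_nhds_nonempty
      (h1.eventually_le_const (pos_iff_ne_zero.2 (hhalf hε)))
    have h2 : Tendsto (fun δ : ℝ => ENNReal.ofReal (2 * δ)) (𝓝[>] 0) (𝓝 0) := by
      have : Continuous fun δ : ℝ => ENNReal.ofReal (2 * δ) :=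
        ENNReal.continuous_ofReal.comp (by fun_prop)
      simpa using (this.tendsto 0).mono_left nhdsWithin_le_nhds
    obtain ⟨δ, hδε, hδ⟩ := ((h2.eventually_le_const (pos_iff_ne_zero.2 (hhalf hε))).and
      self_mem_nhdsWithin).exists
    obtain ⟨q, hq1, hq2⟩ := exists_rat_btwn (lt_add_of_pos_right a hδ)
    obtain ⟨r, hr1, hr2⟩ := exists_rat_btwn (sub_lt_self b hδ)
    refine ⟨window d q r, self_subset_generateSetAlgebra ⟨(d, q, r), ⟨hdD, trivial⟩, rfl⟩, ?_⟩
    have hsub : window d (q : ℝ) r ⊆ window d a b := fun y hy =>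
      ⟨hq1.trans hy.1, hy.2.trans hr2⟩
    have h3 : μ (symmDiff (window d (q : ℝ) r) (window d a b)) ≤ ENNReal.ofReal (2 * δ) := by
      rw [Set.symmDiff_def, Set.sdiff_eq_empty.2 hsub, Set.empty_union, measure_sdiff hsub
        (measurableSet_window _ _ _).nullMeasurableSet (hμ.measure_window_ne_top _ _ _),
        hμ.measure_window, hμ.measure_window, tsub_le_iff_left]
      refine le_trans (ENNReal.ofReal_le_ofReal ?_) ENNReal.ofReal_add_le
      linarith
    refine (MeasureTheory.measure_symmDiff_le _ (window d a b) _).trans ?_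
    rw [← ENNReal.add_halves ε]
    exact add_le_add (h3.trans hδε) ((hμ.measure_symmDiff_le d g a b).trans hd)
  · obtain ⟨s', hs', h1⟩ := hs (ε / 2) (hhalf hε)
    obtain ⟨t', ht', h2⟩ := ht (ε / 2) (hhalf hε)
    refine ⟨s' ∪ t', h𝒜.union_mem hs' ht', ?_⟩
    rw [← ENNReal.add_halves ε]
    exact (measure_mono (Set.union_symmDiff_union_subset)).trans
      ((measure_union_le _ _).trans (add_le_add h1 h2))
  · obtain ⟨s', hs', h1⟩ := hs (ε / 2) (hhalf hε)
    obtain ⟨t', ht', h2⟩ := ht (ε / 2) (hhalf hε)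
    refine ⟨s' \ t', h𝒜.sdiff_mem hs' ht', ?_⟩
    rw [← ENNReal.add_halves ε]
    exact (measure_mono (sdiff_symmDiff_sdiff_subset _ _ _ _)).trans
      ((measure_union_le _ _).trans (add_le_add h1 h2))
  · obtain ⟨s', hs', h1⟩ := hs (ε / 2) (hhalf hε)
    obtain ⟨t', ht', h2⟩ := hs' (ε / 2) (hhalf hε)
    refine ⟨t', ht', (MeasureTheory.measure_symmDiff_le _ s' _).trans ?_⟩
    rw [← ENNReal.add_halves ε]
    exact add_le_add h2 h1

/-- The windows `{y | 0 < y 1 < n + 1}` form a Følner sequence, uniformly over compact sets. -/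
theorem tendstoUniformlyOn_folner_window (hμ : HasWindowEstimates μ ψ)
    (hinv : ∀ g, ψ g⁻¹ = ψ g) (hψ : Continuous ψ) {K : Set G} (hK : IsCompact K) :
    TendstoUniformlyOn (fun (n : ℕ) (g : G) =>
      μ.real (symmDiff (g • window (1 : G) 0 ((n : ℝ) + 1)) (window 1 0 ((n : ℝ) + 1))) /
        μ.real (window (1 : G) 0 ((n : ℝ) + 1))) (fun _ => 0) atTop K := by
  obtain ⟨C, hC⟩ := hK.bddAbove_image (f := fun g => 2 * √(ψ g)) (by fun_prop)
  have h1 : Tendsto (fun n : ℕ => C / ((n : ℝ) + 1)) atTop (𝓝 0) :=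
    tendsto_const_nhds.div_atTop (tendsto_natCast_atTop_atTop.atTop_add tendsto_const_nhds)
  refine Metric.tendstoUniformlyOn_iff.2 fun ε hε => ?_
  filter_upwards [h1.eventually_lt_const hε] with n hn g hg
  have hn0 : (0 : ℝ) ≤ (n : ℝ) + 1 := by positivity
  rw [dist_zero_left, Real.norm_of_nonneg (by positivity)]
  refine lt_of_le_of_lt ?_ hn
  rw [measureReal_def μ (window _ _ _), hμ.measure_window, sub_zero, ENNReal.toReal_ofReal hn0]
  refine div_le_div_of_nonneg_right (le_trans ?_ (hC ⟨g, hg, rfl⟩)) hn0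
  rw [smul_window, mul_one]
  refine ENNReal.toReal_le_of_le_ofReal (by positivity) ?_
  simpa only [mul_one, hinv] using hμ.measure_symmDiff_le g 1 0 ((n : ℝ) + 1)

variable [SMulInvariantMeasure G (PathSpace G) μ]

theorem tendsto_measure_smul_symmDiff_nhds_one [IsTopologicalGroup G]
    (hμ : HasWindowEstimates μ ψ) (hψ1 : ψ 1 = 0) (hψ : Continuous ψ) {A : Set (PathSpace G)}
    (hA : MeasurableSet A) (hμA : μ A ≠ ∞) :
    Tendsto (fun g : G => μ (symmDiff (g • A) A)) (𝓝 1) (𝓝 0) := by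
  refine hμ.mem_of_window_mem
    (C := {A | Tendsto (fun g : G => μ (symmDiff (g • A) A)) (𝓝 1) (𝓝 0)}) (fun h a b => ?_)
    (fun s hs t ht => ?_) (fun s hs t ht => ?_) (fun s hs => ?_) hA hμA
  · refine tendsto_of_tendsto_of_tendsto_of_le_of_le tendsto_const_nhds
      (tendsto_ofReal_sqrt (f := fun g => ψ ((g * h)⁻¹ * h)) ?_) (fun _ => zero_le)
      (fun g => ?_)
    · have : Continuous fun g => ψ ((g * h)⁻¹ * h) := by fun_prop
      simpa [hψ1] using this.tendsto 1
    · rw [smul_window]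
      exact hμ.measure_symmDiff_le _ _ _ _
  · refine tendsto_of_tendsto_of_tendsto_of_le_of_le tendsto_const_nhds
      (by simpa using! hs.add ht) (fun _ => zero_le) (fun g => ?_)
    rw [Set.smul_set_union]
    exact (measure_mono (Set.union_symmDiff_union_subset)).trans (measure_union_le _ _)
  · refine tendsto_of_tendsto_of_tendsto_of_le_of_le tendsto_const_nhds
      (by simpa using! hs.add ht) (fun _ => zero_le) (fun g => ?_)
    rw [Set.smul_set_sdiff]
    exact (measure_mono (sdiff_symmDiff_sdiff_subset _ _ _ _)).trans (measure_union_le _ _)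
  · refine ENNReal.tendsto_nhds_zero.2 fun ε hε => ?_
    have h3 : ε / 3 ≠ 0 := (ENNReal.div_pos hε.ne' (by simp)).ne'
    obtain ⟨t, ht, hts⟩ := hs (ε / 3) h3
    filter_upwards [ENNReal.tendsto_nhds_zero.1 ht (ε / 3) (pos_iff_ne_zero.2 h3)] with g hg
    refine (MeasureTheory.measure_symmDiff_le _ (g • t) _).trans ?_
    rw [measure_smul_symmDiff_smul, symmDiff_comm s t, ← ENNReal.add_thirds ε, add_assoc]
    exact add_le_add hts ((MeasureTheory.measure_symmDiff_le _ t _).trans (add_le_add hg hts))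

theorem isContinuousPermRep [IsTopologicalGroup G] (hμ : HasWindowEstimates μ ψ) (hψ1 : ψ 1 = 0)
    (hψ : Continuous ψ) : IsContinuousPermRep G μ := fun ξ =>
  continuous_smul_Lp ξ (tendsto_smul_Lp_sub_self ENNReal.ofNat_ne_top
    (fun _ hA hμA => hμ.tendsto_measure_smul_symmDiff_nhds_one hψ1 hψ hA hμA) ξ)

theorem isC0DynamicalSystem [IsTopologicalGroup G] (hμ : HasWindowEstimates μ ψ)
    (hψ : Tendsto ψ (cocompact G) atTop) : IsC0DynamicalSystem G μ := by
  intro A B hA hB hμA hμB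
  have hle : ∀ {f f' : G → ℝ≥0∞}, Tendsto f' (cocompact G) (𝓝 0) → (∀ g, f g ≤ f' g) →
      Tendsto f (cocompact G) (𝓝 0) := fun h h' =>
    tendsto_of_tendsto_of_tendsto_of_le_of_le tendsto_const_nhds h (fun _ => zero_le) h'
  have happ : ∀ {f : G → ℝ≥0∞}, (∀ ε : ℝ≥0∞, ε ≠ 0 → ∃ f' : G → ℝ≥0∞,
      Tendsto f' (cocompact G) (𝓝 0) ∧ ∀ g, f g ≤ ε + f' g) → Tendsto f (cocompact G) (𝓝 0) :=
    fun {f} h => ENNReal.tendsto_nhds_zero.2 fun ε hε => by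
      have h2 : ε / 2 ≠ 0 := (ENNReal.half_pos hε.ne').ne'
      obtain ⟨f', hf', hff'⟩ := h _ h2
      filter_upwards [ENNReal.tendsto_nhds_zero.1 hf' _ (pos_iff_ne_zero.2 h2)] with g hg
      exact (hff' g).trans ((add_le_add le_rfl hg).trans_eq (ENNReal.add_halves ε))
  -- both sets may be replaced by windows
  refine hμ.mem_of_window_mem
    (C := {B | Tendsto (fun g : G => μ (g • A ∩ B)) (cocompact G) (𝓝 0)}) (fun h' a' b' => ?_)
    (fun s hs t ht => ?_) (fun s hs t ht => ?_) (fun s hs => ?_) hB hμB.ne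
  · refine hμ.mem_of_window_mem
      (C := {A | Tendsto (fun g : G => μ (g • A ∩ window h' a' b')) (cocompact G) (𝓝 0)})
      (fun h a b => ?_) (fun s hs t ht => ?_) (fun s hs t ht => ?_) (fun s hs => ?_) hA hμA.ne
    · have h1 : Tendsto (fun g : G => ψ ((g * h)⁻¹ * h')) (cocompact G) atTop := by
        have := ((Homeomorph.mulRight h).trans ((Homeomorph.inv G).trans
          (Homeomorph.mulRight h'))).isClosedEmbedding.tendsto_cocompact
        exact hψ.comp this
      set α := min a a'
      set ω := max b b'
      have h2 : Tendsto (fun g : G => ENNReal.ofReal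
          (2 * (ω - α) ^ 2 / √(ψ ((g * h)⁻¹ * h')))) (cocompact G) (𝓝 0) := by
        have := ENNReal.tendsto_ofReal ((Real.tendsto_sqrt_atTop.comp h1).const_div_atTop
          (2 * (ω - α) ^ 2))
        simpa using! this
      -- enlarge both intervals to a common one, which is empty unless `α ≤ ω`
      have hsub : ∀ g : G, μ (g • window h a b ∩ window h' a' b') ≤
          μ (window (g * h) α ω ∩ window h' α ω) := fun g => by
        rw [smul_window]
        exact measure_mono (Set.inter_subset_inter
          (fun y hy => ⟨(min_le_left _ _).trans_lt hy.1, hy.2.trans_le (le_max_left _ _)⟩)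
          (fun y hy => ⟨(min_le_right _ _).trans_lt hy.1, hy.2.trans_le (le_max_right _ _)⟩))
      rcases le_or_gt α ω with hαω | hαω
      · refine tendsto_of_tendsto_of_tendsto_of_le_of_le' tendsto_const_nhds h2
          (Eventually.of_forall fun _ => zero_le) ?_
        filter_upwards [h1.eventually_gt_atTop 0] with g hg
        exact (hsub g).trans (hμ.measure_inter_le _ _ _ _ hg hαω)
      · refine hle tendsto_const_nhds fun g => (hsub g).trans
          ((measure_mono Set.inter_subset_right).trans_eq ?_)
        rw [hμ.measure_window, ENNReal.ofReal_of_nonpos (by linarith)]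
    · refine hle (by simpa using! hs.add ht) fun g => ?_
      rw [Set.smul_set_union, Set.union_inter_distrib_right]
      exact measure_union_le _ _
    · exact hle hs fun g => measure_mono
        (Set.inter_subset_inter_left _ (Set.smul_set_mono Set.sdiff_subset))
    · refine happ fun ε hε => ?_
      obtain ⟨t, ht, hts⟩ := hs ε hε
      refine ⟨_, ht, fun g => ?_⟩
      rw [← measure_smul_symmDiff_smul g, symmDiff_comm] at hts
      refine le_trans (measure_mono ?_) ((measure_union_le _ _).trans (add_le_add hts le_rfl))
      exact inter_subset_symmDiff_union_inter _ _ _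
  · refine hle (by simpa using! hs.add ht) fun g => ?_
    rw [Set.inter_union_distrib_left]
    exact measure_union_le _ _
  · exact hle hs fun g => measure_mono (Set.inter_subset_inter_right _ Set.sdiff_subset)
  · refine happ fun ε hε => ?_
    obtain ⟨t, ht, hts⟩ := hs ε hε
    refine ⟨_, ht, fun g => ?_⟩
    rw [symmDiff_comm] at hts
    refine le_trans (measure_mono ?_) ((measure_union_le _ _).trans (add_le_add hts le_rfl))
    rw [Set.inter_comm, Set.inter_comm _ t]
    exact inter_subset_symmDiff_union_inter _ _ _

theorem hasInvariantMean (hμ : HasWindowEstimates μ ψ) (hinv : ∀ g, ψ g⁻¹ = ψ g)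
    (hψ : Continuous ψ) : HasInvariantMean G μ :=
  hasInvariantMean_of_folner (fun _ => measurableSet_window _ _ _) hμ.measure_window_ne_zero
    (fun _ => hμ.measure_window_ne_top _ _ _) fun g =>
    (hμ.tendstoUniformlyOn_folner_window hinv hψ isCompact_singleton).tendsto_at
      (Set.mem_singleton g)

theorem hasAlmostInvariantUnitVectors (hμ : HasWindowEstimates μ ψ) (hinv : ∀ g, ψ g⁻¹ = ψ g)
    (hψ : Continuous ψ) : HasAlmostInvariantUnitVectors G μ :=
  hasAlmostInvariantUnitVectors_of_folner (fun _ => measurableSet_window _ _ _)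
    hμ.measure_window_ne_zero (fun _ => hμ.measure_window_ne_top _ _ _) fun _ hK =>
    hμ.tendstoUniformlyOn_folner_window hinv hψ hK

end HasWindowEstimates

end ShiftedGaussian

theorem theorem1p3 (G : Type u) [Group G] [TopologicalSpace G] [IsTopologicalGroup G]
    [T2Space G] [LocallyCompactSpace G] [SecondCountableTopology G] :
    (HasHaagerupProperty G →
      ∃ (Ω : Type u) (_ : MeasurableSpace Ω) (_ : MulAction G Ω) (_ : MeasurableConstSMul G Ω)
        (μ : Measure Ω) (_ : SMulInvariantMeasure G Ω μ),
        IsC0DynamicalSystem G μ ∧ HasInvariantMean G μ ∧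
        SigmaFinite μ ∧ TopologicalSpace.SeparableSpace (Lp ℂ 2 μ) ∧
        IsContinuousPermRep G μ ∧ PermRepVanishesAtInfinity G μ ∧
        HasAlmostInvariantUnitVectors G μ) ∧
    (∀ (Ω : Type u) [MeasurableSpace Ω] [MulAction G Ω] [MeasurableConstSMul G Ω]
        (μ : Measure Ω) [SMulInvariantMeasure G Ω μ] [SigmaFinite μ],
        IsC0DynamicalSystem G μ → IsContinuousPermRep G μ → HasInvariantMean G μ →
        HasHaagerupProperty G) := by
  refine ⟨fun h => ?_, fun Ω _ _ _ μ _ _ hC hc hm => hC.hasHaagerupProperty hc hm⟩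
  obtain ⟨ψ, hψ, hψc, hψtop⟩ := h.exists_isConditionallyNegativeDefinite
  obtain ⟨μ, hinv, hμ⟩ := hψ.exists_hasWindowEstimates
  have hC := hμ.isC0DynamicalSystem hψtop
  have : MeasureTheory.IsSeparable μ := hμ.isSeparable hψ.map_one hψc
  have : Fact ((2 : ℝ≥0∞) ≠ ∞) := ⟨ENNReal.ofNat_ne_top⟩
  exact ⟨PathSpace G, inferInstance, inferInstance, inferInstance, μ, hinv, hC,
    hμ.hasInvariantMean hψ.map_inv hψc, hμ.sigmaFinite, inferInstance,
    hμ.isContinuousPermRep hψ.map_one hψc, hC.permRepVanishesAtInfinity,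
    hμ.hasAlmostInvariantUnitVectors hψ.map_inv hψc⟩
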